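/- **Second continuity theorem.** Let $F$ be a connected compact metric space and $M \ge 2$, and let $\psi_1,\dots,\psi_M : F \to F$ be injective strict contractions with $F=\bigcup_i \psi_i(F)$. For a finite word $w = w_1\cdots w_n$ over $I=\{1,\dots,M\}$ put $\psi_w=\psi_{w_1}\circ\cdots\circ\psi_{w_n}$; for an infinite word $\omega$ let $\pi(\omega)$ be the unique point of $\bigcap_n \psi_{\omega_1\cdots\omega_n}(F)$. Let $\sigma$ be the left shift on infinite words, and assume that the post-critical set $P=\bigcup_{n\ge1}\sigma^n\big(\pi^{-1}(\bigcup_{i\ne j}\psi_i(F)\cap\psi_j(F))\big)$ is finite. Put $F^0=\pi(P)$ and $F^m=\bigcup_{|w|=m}\psi_w(F^0)$. Let $(A_0,(r_i)_{i \in I})$ be a regular irreducible harmonic structure: $A_0$ is a real symmetric non-positive definite matrix indexed by $F^0$, with non-negative off-diagonal entries, whose kernel consists exactly of the constant functions; $r_i\in(0,1)$ for all $i$; and, with $\mathcal E_m(u,u)=-\sum_{|w|=m} r_w^{-1}\,(u\circ\psi_w|_{F^0})^{\top}A_0\,(u\circ\psi_w|_{F^0})$ and $r_w=r_{w_1}\cdots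 r_{w_m}$, for every $m\ge0$ and $u:F^m\to\mathbb R$ one has $\mathcal E_m(u,u)=\min\{\mathcal E_{m+1}(v,v): v:F^{m+1}\to\mathbb{R},\ v|_{F^m}=u\}$. Let $\mathcal E(f,f)=\lim_m\mathcal E_m(f|_{F^m},f|_{F^m})$ for $f \in C(F)$, let $\mathcal D=\{f\in C(F):\mathcal E(f,f)<\infty\}$, let $$R(x,y)=\big(\inf\{\mathcal E(f,f): f\in\mathcal D,\ f(x)=0,\ f(y)=1\}\big)^{-1}$$ be the resistance metric, and let $d_H>0$ be the unique number with $\sum_i r_i^{d_H}=1$. Let $(E,\Delta)$ be a complete separable metric space, let $T>0$ (for example $T=1$), and let $\xi=(\xi_{tx}:(t,x)\in[0,T]\times F)$ be an $E$-valued process on a probability space. Suppose that there are $C,\beta,\gamma,\gamma'>0$ such that $$\mathbb E[\Delta(\xi_{tx},\xi_{ty})^\beta]\le C\,R(x,y)^{d_H+1+\gamma},\qquad \mathbb E[\Delta(\xi_{sx},\xi_{tx})^\beta]\le C\,|s-t|^{d_H+1+\gamma'}$$ for all $s,t\in[0,T]$ and all $x,y\in F$. Then there exists a version $\hat\xi=(\hat\xi_{tx})$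 of $\xi$ (each $\hat\xi_{tx}$ is a random variable, and $\hat\xi_{tx}=\xi_{tx}$ almost surely for each $(t,x)$) such that: 1. almost surely, $(t,x)\mapsto\hat\xi_{tx}$ is essentially $\frac{\gamma\wedge\gamma'}{\beta}$-Hölder continuous with respect to $R_\infty((s,x),(t,y))=\max\{|s-t|,R(x,y)\}$; 2. for every $t\in[0,T]$, almost surely, $x\mapsto\hat\xi_{tx}$ is essentially $\frac{1+\gamma}{\beta}$-Hölder continuous with respect to $R$; 3. for every $x\in F$, almost surely, $t\mapsto\hat\xi_{tx}$ is essentially $\frac{d_H+\gamma'}{\beta}$-Hölder continuous with respect to the Euclidean metric. Here, for $\delta>0$, a map $f:(M_1,d_1)\to(M_2,d_2)$ is essentially $\delta$-Hölder continuous if it is continuous and for every $\eta\in(0,\delta)$ there is a constant $c_\eta$ with $d_2(f(p),f(q))\le c_\eta\, d_1(p,q)^\eta$ for all $p,q\in M_1$. -/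

import Mathlib

open MeasureTheory

namespace PCF

/-- A self-similar set: a space `F` which is the union of its images under `M ≥ 2` injective
strict contractions `ψ i`. (Compactness and connectedness of `F` are type-class hypotheses.) -/
structure SelfSimilarSet (M : ℕ) (F : Type*) [MetricSpace F] where
  ψ : Fin M → F → F
  two_le : 2 ≤ M
  injective : ∀ i, Function.Injective (ψ i)
  contracting : ∀ i, ∃ K : NNReal, ContractingWith K (ψ i)
  cover : ⋃ i, Set.range (ψ i) = Set.univ

namespace SelfSimilarSet

variable {M : ℕ} {F : Type*} [MetricSpace F]

/-- `ψ_w = ψ_{w₁} ∘ ⋯ ∘ ψ_{wₙ}` for a finite word `w = w₁ ⋯ wₙ`. -/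
def wordMap (S : SelfSimilarSet M F) : {n : ℕ} → (Fin n → Fin M) → F → F
  | 0, _ => id
  | _ + 1, w => S.ψ (w 0) ∘ S.wordMap (Fin.tail w)

theorem wordMap_succ_last (S : SelfSimilarSet M F) (n : ℕ) (w : Fin (n + 1) → Fin M) :
    S.wordMap w = S.wordMap (Fin.init w) ∘ S.ψ (w (Fin.last n)) := by
  induction n with
  | zero => rfl
  | succ n ih =>
    have h := ih (Fin.tail w)
    change S.ψ (w 0) ∘ S.wordMap (Fin.tail w) = _
    rw [h]
    rfl

/-- The prefix of length `n` of an infinite word. -/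
def wordPrefix (ω : ℕ → Fin M) (n : ℕ) : Fin n → Fin M := fun k => ω k

theorem exists_ratio (S : SelfSimilarSet M F) :
    ∃ K : NNReal, K < 1 ∧ ∀ i, LipschitzWith K (S.ψ i) := by
  choose K hK using S.contracting
  refine ⟨Finset.univ.sup K, ?_, fun i => (hK i).2.weaken (Finset.le_sup (Finset.mem_univ i))⟩
  rw [Finset.sup_lt_iff (by simp)]
  exact fun i _ => (hK i).1

theorem lipschitzWith_wordMap (S : SelfSimilarSet M F) {K : NNReal}
    (hK : ∀ i, LipschitzWith K (S.ψ i)) (n : ℕ) (w : Fin n → Fin M) :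
    LipschitzWith (K ^ n) (S.wordMap w) := by
  induction n with
  | zero => simpa [wordMap] using LipschitzWith.id
  | succ n ih =>
    rw [pow_succ']
    exact (hK (w 0)).comp (ih (Fin.tail w))

/-- An infinite word determines exactly one point of `F`. -/
theorem exists_unique_point [CompactSpace F] [Nonempty F] (S : SelfSimilarSet M F)
    (ω : ℕ → Fin M) : ∃! x : F, ∀ n, x ∈ Set.range (S.wordMap (wordPrefix ω n)) := by
  obtain ⟨K, hK1, hK⟩ := S.exists_ratio
  have hL := fun n => S.lipschitzWith_wordMap hK n (wordPrefix ω n)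
  have hcpt : ∀ n, IsCompact (Set.range (S.wordMap (wordPrefix ω n))) :=
    fun n => isCompact_range (hL n).continuous
  have hne := IsCompact.nonempty_iInter_of_sequence_nonempty_isCompact_isClosed
    (fun n => Set.range (S.wordMap (wordPrefix ω n)))
    (fun n => by
      rintro _ ⟨y, rfl⟩
      rw [S.wordMap_succ_last]
      exact ⟨_, rfl⟩)
    (fun n => Set.range_nonempty _) (hcpt 0) (fun n => (hcpt n).isClosed)
  obtain ⟨x, hx⟩ := hne
  rw [Set.mem_iInter] at hx
  refine ⟨x, hx, fun y hy => ?_⟩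
  have hb : ∀ n : ℕ, dist y x ≤ (K : ℝ) ^ n * Metric.diam (Set.univ : Set F) := by
    intro n
    obtain ⟨a, ha⟩ := hy n
    obtain ⟨b, hb⟩ := hx n
    rw [← ha, ← hb]
    refine ((hL n).dist_le_mul a b).trans ?_
    push_cast
    gcongr
    exact Metric.dist_le_diam_of_mem isCompact_univ.isBounded (Set.mem_univ _) (Set.mem_univ _)
  have ht : Filter.Tendsto (fun n : ℕ => (K : ℝ) ^ n * Metric.diam (Set.univ : Set F))
      Filter.atTop (nhds (0 * Metric.diam (Set.univ : Set F))) :=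
    (tendsto_pow_atTop_nhds_zero_of_lt_one K.2 (by exact_mod_cast hK1)).mul_const _
  rw [zero_mul] at ht
  exact dist_le_zero.1 (ge_of_tendsto' ht hb)

/-- The canonical surjection `π` from infinite words to `F`:
`π ω` is the unique point of `⋂ₙ ψ_{ω₁ ⋯ ωₙ}(F)`. -/
noncomputable def proj [CompactSpace F] [Nonempty F] (S : SelfSimilarSet M F)
    (ω : ℕ → Fin M) : F := (S.exists_unique_point ω).choose

theorem proj_mem [CompactSpace F] [Nonempty F] (S : SelfSimilarSet M F)
    (ω : ℕ → Fin M) (n : ℕ) : S.proj ω ∈ Set.range (S.wordMap (wordPrefix ω n)) :=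
  (S.exists_unique_point ω).choose_spec.1 n

theorem eq_proj [CompactSpace F] [Nonempty F] (S : SelfSimilarSet M F)
    (ω : ℕ → Fin M) (x : F) (hx : ∀ n, x ∈ Set.range (S.wordMap (wordPrefix ω n))) :
    x = S.proj ω :=
  (S.exists_unique_point ω).choose_spec.2 x hx

/-- The union of all overlaps `ψ_i(F) ∩ ψ_j(F)`, `i ≠ j`. -/
def overlap (S : SelfSimilarSet M F) : Set F :=
  {x | ∃ i j, i ≠ j ∧ x ∈ Set.range (S.ψ i) ∩ Set.range (S.ψ j)}

/-- The post-critical set `⋃_{n ≥ 1} σⁿ(π⁻¹(overlap))`, where `σ` is the left shift on infinite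
words. -/
def postCritical [CompactSpace F] [Nonempty F] (S : SelfSimilarSet M F) : Set (ℕ → Fin M) :=
  {ω | ∃ n, 1 ≤ n ∧ ∃ τ : ℕ → Fin M, S.proj τ ∈ S.overlap ∧ ω = fun k => τ (k + n)}

/-- The boundary `F⁰ = π(P)`, where `P` is the post-critical set. -/
def boundary [CompactSpace F] [Nonempty F] (S : SelfSimilarSet M F) : Set F :=
  S.proj '' S.postCritical

/-- `Fⁿ = ⋃_{|w| = n} ψ_w(F⁰)`. -/
def vertices [CompactSpace F] [Nonempty F] (S : SelfSimilarSet M F) (n : ℕ) : Set F :=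
  ⋃ w : Fin n → Fin M, S.wordMap w '' S.boundary

end SelfSimilarSet

/-- A post-critically finite self-similar set. -/
structure PCFSet (M : ℕ) (F : Type*) [MetricSpace F] [CompactSpace F] [Nonempty F]
    extends SelfSimilarSet M F where
  finite_postCritical : toSelfSimilarSet.postCritical.Finite

section Harmonic

variable {M : ℕ} {F : Type*} [MetricSpace F] [CompactSpace F] [Nonempty F]

noncomputable instance (S : PCFSet M F) : Fintype S.boundary :=
  (S.finite_postCritical.image S.proj).fintype

/-- The form `ℰ₀(u,u) = -uᵀ A u` of a matrix `A` indexed by the boundary. -/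
noncomputable def boundaryEnergy (S : PCFSet M F) (A : Matrix S.boundary S.boundary ℝ)
    (u : S.boundary → ℝ) : ℝ := -(u ⬝ᵥ A.mulVec u)

/-- The form `ℰ_m(u,u) = ∑_{|w| = m} r_w⁻¹ ℰ₀(u ∘ ψ_w, u ∘ ψ_w)`, where `r_w = r_{w₁} ⋯ r_{w_m}`.
It depends only on the restriction of `u` to `F^m`. -/
noncomputable def levelEnergy (S : PCFSet M F) (A : Matrix S.boundary S.boundary ℝ)
    (r : Fin M → ℝ) (m : ℕ) (u : F → ℝ) : ℝ :=
  ∑ w : Fin m → Fin M,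
    (∏ k, r (w k))⁻¹ * boundaryEnergy S A (fun p => u (S.wordMap w (p : F)))

/-- A regular irreducible harmonic structure `(A, r)`: `A` is a Laplacian matrix on `F⁰`
(symmetric, non-positive definite, with kernel the constants, non-negative off the diagonal),
`r_i ∈ (0,1)`, and the sequence of forms `ℰ_m` on `F^m` is compatible, that is, `ℰ_m(u,u)` is the
minimum of `ℰ_{m+1}(v,v)` over the extensions `v` of `u|_{F^m}`. -/
structure RegularHarmonicStructure (S : PCFSet M F) where
  A : Matrix S.boundary S.boundary ℝ
  r : Fin M → ℝ
  symm : A.IsSymm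
  nonpos : ∀ u : S.boundary → ℝ, u ⬝ᵥ A.mulVec u ≤ 0
  ker_eq : ∀ u : S.boundary → ℝ, A.mulVec u = 0 ↔ ∃ c : ℝ, ∀ p, u p = c
  offDiag_nonneg : ∀ p q, p ≠ q → 0 ≤ A p q
  r_pos : ∀ i, 0 < r i
  r_lt_one : ∀ i, r i < 1
  compatible : ∀ (m : ℕ) (u : F → ℝ),
    IsLeast {e : ℝ | ∃ v : F → ℝ, (∀ x ∈ S.vertices m, v x = u x) ∧ levelEnergy S A r (m + 1) v = e}
      (levelEnergy S A r m u)

namespace RegularHarmonicStructure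

variable {S : PCFSet M F}

theorem exists_unique_dim (H : RegularHarmonicStructure S) :
    ∃! d : ℝ, 0 < d ∧ ∑ i, H.r i ^ d = 1 := by
  have hM := S.two_le
  have : Nonempty (Fin M) := ⟨⟨0, by omega⟩⟩
  have hcont : Continuous (fun d : ℝ => ∑ i, H.r i ^ d) :=
    continuous_finsetSum _ fun i _ => Real.continuous_const_rpow (H.r_pos i).ne'
  have hanti : StrictAnti (fun d : ℝ => ∑ i, H.r i ^ d) := fun a b hab =>
    Finset.sum_lt_sum_of_nonempty Finset.univ_nonempty fun i _ =>
      Real.rpow_lt_rpow_of_exponent_gt (H.r_pos i) (H.r_lt_one i) hab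
  have h0 : (1 : ℝ) < ∑ i, H.r i ^ (0 : ℝ) := by
    simp only [Real.rpow_zero, Finset.sum_const, Finset.card_univ, Fintype.card_fin, nsmul_eq_mul,
      mul_one]
    exact_mod_cast hM
  have hlim : Filter.Tendsto (fun d : ℝ => ∑ i, H.r i ^ d) Filter.atTop (nhds 0) := by
    have := tendsto_finsetSum (Finset.univ : Finset (Fin M)) (fun i _ =>
      tendsto_rpow_atTop_of_base_lt_one (H.r i) (by linarith [H.r_pos i]) (H.r_lt_one i))
    simpa using this
  obtain ⟨b, hb, hb0⟩ :=
    ((hlim.eventually (gt_mem_nhds (zero_lt_one (α := ℝ)))).and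
      (Filter.eventually_gt_atTop 0)).exists
  obtain ⟨d, hd, hd1⟩ := intermediate_value_Icc' hb0.le hcont.continuousOn ⟨hb.le, h0.le⟩
  refine ⟨d, ⟨lt_of_le_of_ne hd.1 ?_, hd1⟩, fun e he => hanti.injective (he.2.trans hd1.symm)⟩
  rintro rfl
  exact h0.ne' hd1

/-- The Hausdorff dimension `d_H` of `F` for the resistance metric: the unique `d > 0` with
`∑ r_i ^ d = 1`. -/
noncomputable def dimH (H : RegularHarmonicStructure S) : ℝ := H.exists_unique_dim.choose

theorem dimH_spec (H : RegularHarmonicStructure S) :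
    0 < H.dimH ∧ ∑ i, H.r i ^ H.dimH = 1 := H.exists_unique_dim.choose_spec.1

/-- `ℰ(f,f) = lim_m ℰ_m(f,f)` (a non-decreasing limit), with values in `[0,∞]`. The domain of the
Dirichlet form consists of the continuous `f` for which it is finite. -/
noncomputable def energy (H : RegularHarmonicStructure S) (f : C(F, ℝ)) : ENNReal :=
  ⨆ m : ℕ, ENNReal.ofReal (levelEnergy S H.A H.r m f)

/-- The domain of the Dirichlet form. -/
def domain (H : RegularHarmonicStructure S) : Set C(F, ℝ) := {f | H.energy f < ⊤}

/-- The resistance metric `R(x,y) = (inf {ℰ(f,f) : f ∈ 𝒟, f(x) = 0, f(y) = 1})⁻¹`; the infimum over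
the empty set is `∞`, so that `R(x,x) = 0`. -/
noncomputable def R (H : RegularHarmonicStructure S) (x y : F) : ℝ :=
  (⨅ f ∈ {f : C(F, ℝ) | f ∈ H.domain ∧ f x = 0 ∧ f y = 1}, H.energy f)⁻¹.toReal

/-- The metric `R_∞((s,x),(t,y)) = max {|s - t|, R(x,y)}` on `[0,T] × F`. -/
noncomputable def Rinf (H : RegularHarmonicStructure S) (T : ℝ)
    (p q : Set.Icc (0 : ℝ) T × F) : ℝ :=
  max |(p.1 : ℝ) - (q.1 : ℝ)| (H.R p.2 q.2)

end RegularHarmonicStructure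

end Harmonic

/-- `f` is continuous and `η`-Hölder continuous for every `η ∈ (0,δ)`, with respect to the
distance function `d` on its domain. -/
def EssentiallyHolder {X Y : Type*} [MetricSpace Y] (d : X → X → ℝ) (δ : ℝ) (f : X → Y) : Prop :=
  (∀ x, ∀ ε > 0, ∃ η > 0, ∀ y, d x y < η → dist (f x) (f y) < ε) ∧
    ∀ η, 0 < η → η < δ → ∃ c : ℝ, ∀ x y, dist (f x) (f y) ≤ c * d x y ^ η

end PCF

/-! The proof runs a Kolmogorov–Chentsov argument on three index spaces. If a space is covered by
O(δ^(-κ)) balls of radius δ and the β-th moment of an increment is at most C d^(κ+α), then chaining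
along dyadic nets gives a modification that is Hölder for every exponent below α/β
(`exists_essentiallyHolder_modification`). For [0,T] × F one has κ = d_H + 1 and α = min γ γ'; for F
at a fixed time, κ = d_H and α = 1 + γ; for [0,T] at a fixed point, κ = 1 and α = d_H + γ'. A single
version serves all three: a slice of the joint version and the modification built on that slice are
both continuous and agree almost surely on a countable dense set, hence everywhere
(`IsSqPseudoMetric.essentiallyHolder_of_continuous`).

The geometric input is the covering exponent d_H of R (`exists_R_cover`). The identity ℰ_{m+1}(u) =
∑ r_i⁻¹ ℰ_m(u ∘ ψ_i) gives R(ψ_i x, ψ_i y) ≤ r_i R(x,y). Moreover R is bounded: connectedness of F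
links the first-level cells, so energy controls oscillation there, and descending through the levels
adds a geometric series in √(max r_i) (`exists_osc_bound`). Subdividing F into cells, with ∑ r_i^d_H
= 1, then counts the balls.

The estimate (f x - f y)² ≤ R(x,y) ℰ(f,f) yields the triangle inequality for √R directly. The
probabilistic part is therefore stated for squares of pseudo-metrics, where all exponents double and
the doubling cancels at the end. -/

namespace PCF

/-! ### Deterministic chaining along dyadic nets. -/

section Chaining

variable {X : Type*} [PseudoMetricSpace X]

/-- Increments of `f` over pairs of close points in two consecutive nets decay geometrically. -/
def ChainBound {E : Type*} [MetricSpace E] (J : ℕ → Finset X) (η c : ℝ) (f : X → E) : Prop :=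
  ∀ n, ∀ s t, (s ∈ J n ∨ s ∈ J (n + 1)) → (t ∈ J n ∨ t ∈ J (n + 1)) →
    dist s t ≤ 4 * (1 / 2) ^ n → dist (f s) (f t) ≤ c * ((1 / 2 : ℝ) ^ η) ^ n

theorem half_rpow_lt_one {η : ℝ} (hη : 0 < η) : (1 / 2 : ℝ) ^ η < 1 :=
  Real.rpow_lt_one (by norm_num) (by norm_num) hη

theorem ChainBound.dist_succ_le {E : Type*} [MetricSpace E] {J : ℕ → Finset X} {η c : ℝ}
    {f : X → E} (h : ChainBound J η c f) {p : ℕ → X → X}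
    (hp : ∀ n x, p n x ∈ J n) (hpd : ∀ n x, dist x (p n x) ≤ (1 / 2) ^ n) (x : X) (n : ℕ) :
    dist (f (p n x)) (f (p (n + 1) x)) ≤ c * ((1 / 2 : ℝ) ^ η) ^ n := by
  refine h n _ _ (Or.inl (hp n x)) (Or.inr (hp (n + 1) x)) ?_
  have h1 := dist_triangle_left (p n x) (p (n + 1) x) x
  have h2 := hpd n x
  have h3 := hpd (n + 1) x
  have h4 : (0 : ℝ) < (1 / 2) ^ n := by positivity
  rw [pow_succ] at h3
  linarith

theorem ChainBound.cauchySeq {E : Type*} [MetricSpace E] {J : ℕ → Finset X} {η c : ℝ}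
    (hη : 0 < η) {f : X → E} (h : ChainBound J η c f) {p : ℕ → X → X}
    (hp : ∀ n x, p n x ∈ J n) (hpd : ∀ n x, dist x (p n x) ≤ (1 / 2) ^ n) (x : X) :
    CauchySeq (fun n => f (p n x)) :=
  cauchySeq_of_le_geometric _ c (half_rpow_lt_one hη) (h.dist_succ_le hp hpd x)

/-- At scale 2^(-n), x and y are joined through `p n x` and `p n y`, and the two tails of the chains
are geometric series. The net points are within 3 · 2^(-n) of each other, which the factor 4 in
`ChainBound` allows. -/
theorem ChainBound.holder {E : Type*} [MetricSpace E] {J : ℕ → Finset X} {η c : ℝ}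
    (hη : 0 < η) {f : X → E} (h : ChainBound J η c f) {p : ℕ → X → X}
    (hp : ∀ n x, p n x ∈ J n) (hpd : ∀ n x, dist x (p n x) ≤ (1 / 2) ^ n) {g : X → E}
    (hg : ∀ x, Filter.Tendsto (fun n => f (p n x)) Filter.atTop (nhds (g x))) :
    ∃ c' : ℝ, ∀ x y, dist (g x) (g y) ≤ c' * dist x y ^ η := by
  set q : ℝ := (1 / 2 : ℝ) ^ η with hq
  have hq0 : 0 < q := by positivity
  have hq1 : q < 1 := half_rpow_lt_one hη
  have hlim : ∀ n x, dist (f (p n x)) (g x) ≤ c * q ^ n / (1 - q) := fun n x =>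
    dist_le_of_le_geometric_of_tendsto q c hq1 (h.dist_succ_le hp hpd x) (hg x) n
  rcases isEmpty_or_nonempty X with hX | ⟨⟨x₀⟩⟩
  · exact ⟨0, fun x => hX.elim x⟩
  have hc : 0 ≤ c := by
    have := h.dist_succ_le hp hpd x₀ 0
    simpa using dist_nonneg.trans this
  -- Pairs at distance greater than 1 are outside the reach of the chain bound; their increments are
  -- controlled through the finite net `J 0`.
  set B : ℝ := ∑ s ∈ J 0, ∑ t ∈ J 0, dist (f s) (f t) with hB
  have hB0 : 0 ≤ B := Finset.sum_nonneg fun _ _ => Finset.sum_nonneg fun _ _ => dist_nonneg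
  set D : ℝ := 2 * c / (1 - q) + c with hD
  have h1q : 0 < 1 - q := by linarith
  have hD0 : 0 ≤ D := by positivity
  have hnear : ∀ n x y, dist x y ≤ (1 / 2) ^ n → dist (g x) (g y) ≤ D * q ^ n := by
    intro n x y hxy
    have h1 : dist (f (p n x)) (f (p n y)) ≤ c * q ^ n := by
      refine h n _ _ (Or.inl (hp n x)) (Or.inl (hp n y)) ?_
      have := dist_triangle4 (p n x) x y (p n y)
      rw [dist_comm (p n x) x] at this
      have h4 : (0 : ℝ) < (1 / 2) ^ n := by positivity
      linarith [hpd n x, hpd n y]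
    have h2 := dist_triangle4 (g x) (f (p n x)) (f (p n y)) (g y)
    rw [dist_comm (g x) (f _)] at h2
    have h3 := hlim n x
    have h4 := hlim n y
    have h5 : D * q ^ n = c * q ^ n / (1 - q) + c * q ^ n + c * q ^ n / (1 - q) := by
      rw [hD]; ring
    linarith
  refine ⟨D * 2 ^ η + (2 * c / (1 - q) + B), fun x y => ?_⟩
  have hE0 : 0 ≤ 2 * c / (1 - q) + B := by positivity
  -- In a pseudo-metric space distinct points may have distance 0; then the near estimate holds at
  -- every scale.
  rcases (dist_nonneg (x := x) (y := y)).eq_or_lt with h0 | h0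
  · rw [← h0, Real.zero_rpow hη.ne', mul_zero]
    have ht : Filter.Tendsto (fun n : ℕ => D * q ^ n) Filter.atTop (nhds (D * 0)) :=
      (tendsto_pow_atTop_nhds_zero_of_lt_one hq0.le hq1).const_mul D
    rw [mul_zero] at ht
    exact ge_of_tendsto' ht fun n => hnear n x y (by rw [← h0]; positivity)
  have hpos : 0 < dist x y ^ η := Real.rpow_pos_of_pos h0 _
  rcases le_or_gt (dist x y) 1 with h1 | h1
  · obtain ⟨n, hn1, hn2⟩ := exists_nat_pow_near_of_lt_one h0 h1 (y := (1 / 2 : ℝ))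
      (by norm_num) (by norm_num)
    have h2 : q ^ n ≤ 2 ^ η * dist x y ^ η := by
      rw [← Real.mul_rpow (by norm_num) h0.le, hq, ← Real.rpow_natCast, ← Real.rpow_mul (by norm_num),
        mul_comm, Real.rpow_mul (by norm_num), Real.rpow_natCast]
      refine Real.rpow_le_rpow (by positivity) ?_ hη.le
      rw [pow_succ] at hn1
      linarith
    calc dist (g x) (g y) ≤ D * q ^ n := hnear n x y hn2
      _ ≤ D * (2 ^ η * dist x y ^ η) := by gcongr
      _ = (D * 2 ^ η) * dist x y ^ η := by ring
      _ ≤ _ := by gcongr; linarith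
  · have h2 : dist (f (p 0 x)) (f (p 0 y)) ≤ B := by
      refine le_trans ?_ (Finset.single_le_sum (f := fun s => ∑ t ∈ J 0, dist (f s) (f t))
        (fun _ _ => Finset.sum_nonneg fun _ _ => dist_nonneg) (hp 0 x))
      exact Finset.single_le_sum (f := fun t => dist (f (p 0 x)) (f t))
        (fun _ _ => dist_nonneg) (hp 0 y)
    have h3 := dist_triangle4 (g x) (f (p 0 x)) (f (p 0 y)) (g y)
    rw [dist_comm (g x) (f _)] at h3
    have h4 := hlim 0 x
    have h5 := hlim 0 y
    rw [pow_zero, mul_one] at h4 h5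
    have h6 : dist (g x) (g y) ≤ 2 * c / (1 - q) + B := by
      have : 2 * c / (1 - q) = c / (1 - q) + c / (1 - q) := by ring
      linarith
    have h7 : 1 ≤ dist x y ^ η := Real.one_le_rpow h1.le hη.le
    have h8 : 0 ≤ D * 2 ^ η := by positivity
    calc dist (g x) (g y) ≤ (2 * c / (1 - q) + B) * 1 := by linarith
      _ ≤ (D * 2 ^ η + (2 * c / (1 - q) + B)) * dist x y ^ η :=
        mul_le_mul (by linarith) h7 zero_le_one (by linarith)

/-- Only about `a * J.card` pairs need control instead of `J.card ^ 2`, at the price of a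
logarithmic factor `n` in their distance. This is why a moment exponent κ + α suffices, rather than
2κ + α. -/
theorem exists_pair_reduction (J : Finset X) {a : ENNReal} {n : ℕ} (hJ : (J.card : ENNReal) ≤ a ^ n)
    (c : ENNReal) (E : Type*) [MetricSpace E] :
    ∃ K : Finset (X × X), (K.card : ENNReal) ≤ a * J.card ∧
      (∀ p ∈ K, edist p.1 p.2 ≤ n * c) ∧
      ∀ (f : X → E) (B : ENNReal), (∀ p ∈ K, edist (f p.1) (f p.2) ≤ B) →
        ∀ s ∈ J, ∀ t ∈ J, edist s t ≤ c → edist (f s) (f t) ≤ 2 * B := by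
  obtain ⟨K, -, h2, h3, h4⟩ := EMetric.pair_reduction hJ c E
  refine ⟨K, h2, fun p hp => h3 _ _ hp, fun f B hB s hs t ht hst => ?_⟩
  have h5 : ⨆ p : K, edist (f p.1.1) (f p.1.2) ≤ B := iSup_le fun p => hB _ p.2
  refine le_trans ?_ ((h4 f).trans (by gcongr))
  exact le_iSup₂ (f := fun (s : J) (t : { t : J // edist (s : X) t ≤ c }) =>
    edist (f s) (f t)) ⟨s, hs⟩ ⟨⟨t, ht⟩, hst⟩

end Chaining

/-! ### Moment bounds and the Kolmogorov–Chentsov modification. -/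

theorem summable_rpow_mul_geometric (s : ℝ) {ρ : ℝ} (h0 : 0 < ρ) (h1 : ρ < 1) :
    Summable (fun n : ℕ => ((n : ℝ) + 1) ^ s * ρ ^ n) := by
  obtain ⟨k, hk⟩ := exists_nat_ge s
  have h := (summable_nat_add_iff 1).2 (summable_pow_mul_geometric_of_norm_lt_one k
    (r := ρ) (by rwa [Real.norm_of_nonneg h0.le]))
  refine Summable.of_nonneg_of_le (fun n => by positivity) (fun n => ?_) (h.mul_left ρ⁻¹)
  have h2 : ((n : ℝ) + 1) ^ s ≤ ((n : ℝ) + 1) ^ k := by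
    rw [← Real.rpow_natCast]
    exact Real.rpow_le_rpow_of_exponent_le (by linarith [n.cast_nonneg (α := ℝ)]) hk
  have h3 : ρ⁻¹ * (((n + 1 : ℕ) : ℝ) ^ k * ρ ^ (n + 1)) = ((n : ℝ) + 1) ^ k * ρ ^ n := by
    push_cast
    rw [pow_succ ρ]
    field_simp
  rw [h3]
  gcongr

section Kolmogorov

variable {X : Type*} [PseudoMetricSpace X] {E : Type*} [MetricSpace E]
  {Ω : Type*} [MeasurableSpace Ω]

/-- `Z` sums 2^(ηβn) times the β-th powers of the increments over the reduced pairs at level n.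
There are O(2^(κn)) such pairs, each with moment O(((n+1) 2^(-n))^(κ+α)), so the expectation is a
series of order (n+1)^(κ+α) 2^((ηβ-α)n), finite as ηβ < α. Each term is at most `Z`, and a β-th root
gives the chain bound. -/
theorem exists_chain_functional [SecondCountableTopology E] [MeasurableSpace E] [BorelSpace E]
    (P : Measure Ω) (ξ : X → Ω → E) (hξ : ∀ x, Measurable (ξ x))
    {A κ C α β η : ℝ} (hA : 1 ≤ A) (hκ : 0 ≤ κ) (hC : 0 < C) (hα : 0 < α) (hβ : 0 < β)
    (hηα : η * β < α) (J : ℕ → Finset X)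
    (hJ : ∀ n, ((J n).card : ℝ) ≤ A * ((2 : ℝ) ^ κ) ^ n)
    (hmom : ∀ s t, ∫⁻ ω, edist (ξ s ω) (ξ t ω) ^ β ∂P
      ≤ ENNReal.ofReal (C * dist s t ^ (κ + α))) :
    ∃ Z : Ω → ENNReal, Measurable Z ∧ ∫⁻ ω, Z ω ∂P ≠ ⊤ ∧
      ∀ ω, Z ω ≠ ⊤ → ∃ c, ChainBound J η c (fun x => ξ x ω) := by
  classical
  set x : ℝ := (2 : ℝ) ^ κ with hx
  have hx1 : 1 ≤ x := Real.one_le_rpow (by norm_num) hκ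
  -- With this base, the union of two consecutive nets has at most `b ^ (n + 1)` points, so pair
  -- reduction loses only the factor n + 1.
  set b : ℝ := 2 * A * x with hb
  set y : ℝ := (2 : ℝ) ^ (η * β) with hy
  have hy0 : 0 < y := by positivity
  have hA2 : 1 ≤ 2 * A := by linarith
  have hcardI : ∀ n, ((J n ∪ J (n + 1)).card : ℝ) ≤ 2 * A * x ^ (n + 1) := by
    intro n
    have h1 : ((J n ∪ J (n + 1)).card : ℝ) ≤ (J n).card + (J (n + 1)).card := by
      exact_mod_cast Finset.card_union_le _ _
    have h2 : A * x ^ n ≤ A * x ^ (n + 1) := by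
      gcongr
      omega
    linarith [hJ n, hJ (n + 1)]
  have hcardI' : ∀ n, (((J n ∪ J (n + 1)).card : ℕ) : ENNReal) ≤ ENNReal.ofReal b ^ (n + 1) := by
    intro n
    rw [← ENNReal.ofReal_pow (by positivity), ← ENNReal.ofReal_natCast]
    refine ENNReal.ofReal_le_ofReal ((hcardI n).trans ?_)
    rw [hb, mul_pow]
    gcongr
    exact le_self_pow₀ hA2 (by omega)
  choose K hK1 hK2 hK3 using fun n => exists_pair_reduction (J n ∪ J (n + 1)) (hcardI' n)
    (ENNReal.ofReal (4 * (1 / 2) ^ n)) E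
  have hKcard : ∀ n, ((K n).card : ENNReal) ≤ ENNReal.ofReal (b * (2 * A * x ^ (n + 1))) := by
    intro n
    refine (hK1 n).trans ?_
    rw [ENNReal.ofReal_mul (p := b) (by positivity)]
    refine mul_le_mul' le_rfl ?_
    rw [← ENNReal.ofReal_natCast]
    exact ENNReal.ofReal_le_ofReal (hcardI n)
  have hmeas : ∀ s t, Measurable fun ω => edist (ξ s ω) (ξ t ω) ^ β := fun s t =>
    ((hξ s).edist (hξ t)).pow_const β
  have hmomK : ∀ n, ∀ p ∈ K n, ∫⁻ ω, edist (ξ p.1 ω) (ξ p.2 ω) ^ β ∂P ≤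
      ENNReal.ofReal (C * (((n : ℝ) + 1) * (4 * (1 / 2) ^ n)) ^ (κ + α)) := by
    intro n p hp
    refine (hmom _ _).trans (ENNReal.ofReal_le_ofReal ?_)
    have h := hK2 n p hp
    rw [edist_dist, ← ENNReal.ofReal_natCast, ← ENNReal.ofReal_mul (by positivity),
      ENNReal.ofReal_le_ofReal_iff (by positivity)] at h
    push_cast at h
    gcongr
  refine ⟨fun ω => ∑' n, ENNReal.ofReal (y ^ n) *
    ∑ p ∈ K n, edist (ξ p.1 ω) (ξ p.2 ω) ^ β, ?_, ?_, ?_⟩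
  · exact Measurable.tsum fun n =>
      (Finset.measurable_sum _ fun p _ => hmeas _ _).const_mul _
  · rw [lintegral_tsum fun n =>
      ((Finset.measurable_sum _ fun p _ => hmeas _ _).const_mul _).aemeasurable]
    set ρ : ℝ := y * x * (1 / 2) ^ (κ + α) with hρ
    have hρ0 : 0 < ρ := by positivity
    have hρ1 : ρ < 1 := by
      have : ρ = 2 ^ (η * β - α) := by
        rw [hρ, hy, hx, one_div, Real.inv_rpow (by norm_num), ← Real.rpow_neg (by norm_num),
          ← Real.rpow_add (by norm_num), ← Real.rpow_add (by norm_num)]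
        congr 1
        ring
      rw [this]
      exact Real.rpow_lt_one_of_one_lt_of_neg (by norm_num) (by linarith)
    have hsum := (summable_rpow_mul_geometric (κ + α) hρ0 hρ1).mul_left
      (b * (2 * A * x) * C * 4 ^ (κ + α))
    refine ne_top_of_le_ne_top hsum.tsum_ofReal_ne_top (ENNReal.tsum_le_tsum fun n => ?_)
    rw [lintegral_const_mul _ (Finset.measurable_sum _ fun p _ => hmeas _ _),
      lintegral_finsetSum _ fun p _ => hmeas _ _]
    calc ENNReal.ofReal (y ^ n) * ∑ p ∈ K n, ∫⁻ ω, edist (ξ p.1 ω) (ξ p.2 ω) ^ β ∂P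
        ≤ ENNReal.ofReal (y ^ n) * ((K n).card *
          ENNReal.ofReal (C * (((n : ℝ) + 1) * (4 * (1 / 2) ^ n)) ^ (κ + α))) := by
          gcongr
          exact (Finset.sum_le_card_nsmul _ _ _ (hmomK n)).trans_eq (nsmul_eq_mul _ _)
      _ ≤ ENNReal.ofReal (y ^ n) * (ENNReal.ofReal (b * (2 * A * x ^ (n + 1))) *
          ENNReal.ofReal (C * (((n : ℝ) + 1) * (4 * (1 / 2) ^ n)) ^ (κ + α))) := by
          gcongr
          exact hKcard n
      _ = _ := by
          rw [← ENNReal.ofReal_mul (by positivity), ← ENNReal.ofReal_mul (by positivity)]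
          congr 1
          rw [Real.mul_rpow (by positivity) (by positivity),
            Real.mul_rpow (by positivity) (by positivity), hρ, mul_pow, mul_pow,
            ← Real.rpow_natCast ((1 / 2 : ℝ) ^ (κ + α)), ← Real.rpow_mul (by norm_num),
            mul_comm (κ + α) (n : ℝ), Real.rpow_mul (by norm_num), Real.rpow_natCast, pow_succ]
          ring
  · intro ω hω
    set Z := ∑' n, ENNReal.ofReal (y ^ n) *
      ∑ p ∈ K n, edist (ξ p.1 ω) (ξ p.2 ω) ^ β with hZ
    have hq : ∀ n : ℕ, (y ^ n)⁻¹ ^ β⁻¹ = ((1 / 2 : ℝ) ^ η) ^ n := by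
      intro n
      rw [← inv_pow, hy, ← Real.inv_rpow (by norm_num), ← one_div, ← Real.rpow_natCast,
        ← Real.rpow_mul (by positivity), mul_comm (n : ℝ), Real.rpow_mul (by positivity),
        Real.rpow_natCast, Real.rpow_mul (by norm_num), ← Real.rpow_mul (by positivity),
        mul_inv_cancel₀ hβ.ne', Real.rpow_one]
    refine ⟨2 * (Z ^ β⁻¹).toReal, fun n s t hs ht hst => ?_⟩
    have h1 : ∀ p ∈ K n, edist (ξ p.1 ω) (ξ p.2 ω) ≤
        Z ^ β⁻¹ * ENNReal.ofReal (((1 / 2 : ℝ) ^ η) ^ n) := by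
      intro p hp
      have h2 : ENNReal.ofReal (y ^ n) * edist (ξ p.1 ω) (ξ p.2 ω) ^ β ≤ Z := by
        refine le_trans ?_ (ENNReal.le_tsum n)
        gcongr
        exact Finset.single_le_sum (f := fun p : X × X => edist (ξ p.1 ω) (ξ p.2 ω) ^ β)
          (fun _ _ => zero_le) hp
      have h3 : edist (ξ p.1 ω) (ξ p.2 ω) ^ β ≤ Z * ENNReal.ofReal ((y ^ n)⁻¹) := by
        rw [ENNReal.ofReal_inv_of_pos (by positivity), ← div_eq_mul_inv,
          ENNReal.le_div_iff_mul_le (Or.inl (by simpa using by positivity))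
            (Or.inl ENNReal.ofReal_ne_top), mul_comm]
        exact h2
      have h4 := ENNReal.rpow_le_rpow h3 (inv_nonneg.2 hβ.le)
      rwa [ENNReal.rpow_rpow_inv hβ.ne', ENNReal.mul_rpow_of_nonneg _ _ (inv_nonneg.2 hβ.le),
        ENNReal.ofReal_rpow_of_nonneg (by positivity) (inv_nonneg.2 hβ.le), hq] at h4
    have h5 := hK3 n (fun x => ξ x ω) _ h1 s (by simpa using hs) t (by simpa using ht)
      (by rw [edist_dist]; exact ENNReal.ofReal_le_ofReal hst)
    have hfin : Z ^ β⁻¹ ≠ ⊤ := ENNReal.rpow_ne_top_of_nonneg (inv_nonneg.2 hβ.le) hω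
    have h6 := ENNReal.toReal_mono (by finiteness) h5
    rw [edist_dist, ENNReal.toReal_ofReal dist_nonneg, ENNReal.toReal_mul, ENNReal.toReal_mul,
      ENNReal.toReal_ofReal (by positivity)] at h6
    simpa [mul_assoc] using h6

end Kolmogorov

section Kolmogorov

variable {X : Type*} [PseudoMetricSpace X] {E : Type*} [MetricSpace E]
  {Ω : Type*} [MeasurableSpace Ω]

theorem essentiallyHolder_of_holder {Y : Type*} {d : Y → Y → ℝ} (hd : ∀ x y, 0 ≤ d x y)
    {δ : ℝ} (hδ : 0 < δ) {f : Y → E}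
    (h : ∀ η, 0 < η → η < δ → ∃ c : ℝ, ∀ x y, dist (f x) (f y) ≤ c * d x y ^ η) :
    EssentiallyHolder d δ f := by
  refine ⟨fun x ε hε => ?_, h⟩
  obtain ⟨c, hc⟩ := h (δ / 2) (by linarith) (by linarith)
  have hc' : (0 : ℝ) < |c| + 1 := by positivity
  refine ⟨(ε / (|c| + 1)) ^ (δ / 2)⁻¹, by positivity, fun y hy => ?_⟩
  have h1 : d x y ^ (δ / 2) < ε / (|c| + 1) := by
    have := Real.rpow_lt_rpow (hd x y) hy (z := δ / 2) (by linarith)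
    rwa [← Real.rpow_mul (by positivity), inv_mul_cancel₀ (by positivity), Real.rpow_one] at this
  have h2 : 0 ≤ d x y ^ (δ / 2) := Real.rpow_nonneg (hd x y) _
  calc dist (f x) (f y) ≤ c * d x y ^ (δ / 2) := hc x y
    _ ≤ (|c| + 1) * d x y ^ (δ / 2) := by gcongr; linarith [le_abs_self c]
    _ < (|c| + 1) * (ε / (|c| + 1)) := by gcongr
    _ = ε := by field_simp

/-- A Kolmogorov–Chentsov theorem on a pseudo-metric space of finite Minkowski dimension. -/
theorem exists_essentiallyHolder_modification [CompleteSpace E] [SecondCountableTopology E]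
    [Nonempty E] [MeasurableSpace E] [BorelSpace E]
    (P : Measure Ω) (ξ : X → Ω → E) (hξ : ∀ x, Measurable (ξ x))
    {A κ C α β : ℝ} (hA : 1 ≤ A) (hκ : 0 ≤ κ) (hC : 0 < C) (hα : 0 < α) (hβ : 0 < β)
    (hcov : ∀ δ : ℝ, 0 < δ → δ ≤ 1 → ∃ J : Finset X, (J.card : ℝ) ≤ A * δ ^ (-κ) ∧
      ∀ x, ∃ y ∈ J, dist x y ≤ δ)
    (hmom : ∀ s t, ∫⁻ ω, edist (ξ s ω) (ξ t ω) ^ β ∂P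
      ≤ ENNReal.ofReal (C * dist s t ^ (κ + α))) :
    ∃ ξ' : X → Ω → E, (∀ x, Measurable (ξ' x)) ∧ (∀ x, ∀ᵐ ω ∂P, ξ' x ω = ξ x ω) ∧
      ∀ᵐ ω ∂P, EssentiallyHolder dist (α / β) (fun x => ξ' x ω) := by
  classical
  choose J hJ hJcov using fun n : ℕ => hcov ((1 / 2) ^ n) (by positivity)
    (pow_le_one₀ (by norm_num) (by norm_num))
  choose p hp hpd using hJcov
  have hJ' : ∀ n, ((J n).card : ℝ) ≤ A * ((2 : ℝ) ^ κ) ^ n := by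
    intro n
    convert hJ n using 2
    rw [← Real.rpow_natCast, ← Real.rpow_natCast, ← Real.rpow_mul (by norm_num),
      ← Real.rpow_mul (by norm_num), one_div, Real.inv_rpow (by norm_num),
      ← Real.rpow_neg (by norm_num)]
    congr 1
    ring
  have hδ : 0 < α / β := by positivity
  -- Countably many exponents increasing to α/β; the shift by 2 keeps `η 0` positive.
  set η : ℕ → ℝ := fun k => α / β * (1 - 1 / ((k : ℝ) + 2)) with hη
  have hη0 : ∀ k, 0 < η k := by
    intro k
    have : 1 / ((k : ℝ) + 2) < 1 := by
      rw [div_lt_one (by positivity)]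
      linarith [k.cast_nonneg (α := ℝ)]
    exact mul_pos hδ (by linarith)
  have hη1 : ∀ k, η k * β < α := by
    intro k
    have h1 : (0 : ℝ) < 1 / ((k : ℝ) + 2) := by positivity
    have h2 : η k * β = α * (1 - 1 / ((k : ℝ) + 2)) := by
      simp only [hη]
      field_simp
    rw [h2]
    nlinarith
  choose Z hZm hZi hZ using fun k =>
    exists_chain_functional P ξ hξ hA hκ hC hα hβ (hη1 k) J hJ' hmom
  set G : Set Ω := {ω | ∀ k, Z k ω < ⊤} with hG
  have hGm : MeasurableSet G := by
    rw [hG, Set.ofPred_forall]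
    exact MeasurableSet.iInter fun k => measurableSet_lt (hZm k) measurable_const
  have hGae : ∀ᵐ ω ∂P, ω ∈ G := ae_all_iff.2 fun k => ae_lt_top (hZm k) (hZi k)
  obtain ⟨e₀⟩ := ‹Nonempty E›
  -- The constant `e₀` off the good event `G` makes the limit exist for every ω, so the limit is
  -- measurable.
  set u : ℕ → X → Ω → E := fun n x ω => if ω ∈ G then ξ (p n x) ω else e₀ with hu
  have hconv : ∀ x ω, ∃ e, Filter.Tendsto (fun n => u n x ω) Filter.atTop (nhds e) := by
    intro x ω
    by_cases hω : ω ∈ G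
    · obtain ⟨c, hc⟩ := hZ 0 ω (hω 0).ne
      simpa [hu, hω] using cauchySeq_tendsto_of_complete (hc.cauchySeq (hη0 0) hp hpd x)
    · exact ⟨e₀, by simp [hu, hω]⟩
  choose ξ' hξ' using hconv
  refine ⟨ξ', fun x => ?_, fun x => ?_, ?_⟩
  · refine measurable_of_tendsto_metrizable (f := fun n => u n x) (fun n => ?_)
      (tendsto_pi_nhds.2 fun ω => hξ' x ω)
    exact Measurable.ite hGm (hξ _) measurable_const
  · have hm : ∀ n, Measurable fun ω => edist (ξ x ω) (ξ (p n x) ω) ^ β := fun n =>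
      ((hξ _).edist (hξ _)).pow_const β
    -- The moments along the net approximations of x are summable, so ξ at those points converges
    -- almost surely to ξ at x.
    have hsum : ∫⁻ ω, ∑' n, edist (ξ x ω) (ξ (p n x) ω) ^ β ∂P ≠ ⊤ := by
      rw [lintegral_tsum fun n => (hm n).aemeasurable]
      have hs : Summable fun n : ℕ => C * ((1 / 2 : ℝ) ^ (κ + α)) ^ n :=
        (summable_geometric_of_lt_one (by positivity)
          (half_rpow_lt_one (by linarith))).mul_left C
      refine ne_top_of_le_ne_top hs.tsum_ofReal_ne_top (ENNReal.tsum_le_tsum fun n => ?_)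
      refine (hmom _ _).trans (ENNReal.ofReal_le_ofReal ?_)
      rw [← Real.rpow_natCast, ← Real.rpow_mul (by norm_num), mul_comm (κ + α),
        Real.rpow_mul (by norm_num), Real.rpow_natCast]
      have := hpd n x
      gcongr
    filter_upwards [hGae, ae_lt_top (Measurable.tsum hm) hsum] with ω hω hlt
    have h1 : Filter.Tendsto (fun n => edist (ξ x ω) (ξ (p n x) ω) ^ β) Filter.atTop (nhds 0) :=
      ENNReal.tendsto_atTop_zero_of_tsum_ne_top hlt.ne
    have h2 : Filter.Tendsto (fun n => edist (ξ x ω) (ξ (p n x) ω)) Filter.atTop (nhds 0) := by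
      have h3 := (ENNReal.continuous_rpow_const (y := β⁻¹)).continuousAt.tendsto.comp h1
      rw [ENNReal.zero_rpow_of_pos (by positivity)] at h3
      refine h3.congr fun n => ?_
      simp [ENNReal.rpow_rpow_inv hβ.ne']
    have h3 : Filter.Tendsto (fun n => ξ (p n x) ω) Filter.atTop (nhds (ξ x ω)) := by
      rw [tendsto_iff_edist_tendsto_0]
      simpa only [edist_comm] using h2
    refine tendsto_nhds_unique (hξ' x ω) (h3.congr fun n => ?_)
    simp [hu, hω]
  · filter_upwards [hGae] with ω hω
    have hlim : ∀ x, Filter.Tendsto (fun n => ξ (p n x) ω) Filter.atTop (nhds (ξ' x ω)) :=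
      fun x => (hξ' x ω).congr fun n => by simp [hu, hω]
    have hk : ∀ k, ∃ c : ℝ, ∀ x y, dist (ξ' x ω) (ξ' y ω) ≤ c * dist x y ^ η k := by
      intro k
      obtain ⟨c, hc⟩ := hZ k ω (hω k).ne
      exact hc.holder (hη0 k) hp hpd hlim
    refine essentiallyHolder_of_holder (fun _ _ => dist_nonneg) hδ fun e he0 he1 => ?_
    obtain ⟨k, hk1⟩ : ∃ k, e ≤ η k := by
      have h1 : Filter.Tendsto η Filter.atTop (nhds (α / β * (1 - 0))) := by
        refine (tendsto_const_nhds.sub ?_).const_mul _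
        have := (tendsto_one_div_add_atTop_nhds_zero_nat (𝕜 := ℝ)).comp (Filter.tendsto_add_atTop_nat 1)
        refine this.congr fun n => ?_
        simp only [Function.comp, Nat.cast_add, Nat.cast_one]
        ring
      rw [sub_zero, mul_one] at h1
      exact (h1.eventually (le_mem_nhds he1)).exists
    obtain ⟨c, hc⟩ := hk k
    -- The space is bounded, so the exponent `η k` may be lowered to `e`.
    obtain ⟨c₀, hc₀⟩ : ∃ D : ℝ, ∀ x y : X, dist x y ≤ D := by
      obtain ⟨J₁, -, hJ₁⟩ := hcov 1 one_pos le_rfl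
      have hb : Bornology.IsBounded (Set.univ : Set X) := by
        refine ((Bornology.isBounded_biUnion_finset J₁).2 fun y _ => Metric.isBounded_closedBall
          (x := y) (r := 1)).subset fun x _ => ?_
        obtain ⟨y, hy, hxy⟩ := hJ₁ x
        exact Set.mem_biUnion hy hxy
      obtain ⟨D, hD⟩ := Metric.isBounded_iff.1 hb
      exact ⟨D, fun x y => hD (Set.mem_univ x) (Set.mem_univ y)⟩
    refine ⟨|c| * |c₀| ^ (η k - e), fun x y => (hc x y).trans ?_⟩
    have h1 : dist x y ^ η k = dist x y ^ (η k - e) * dist x y ^ e := by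
      rw [← Real.rpow_add_of_nonneg dist_nonneg (by linarith) he0.le, sub_add_cancel]
    rw [h1, ← mul_assoc]
    have h2 : dist x y ≤ |c₀| := (hc₀ x y).trans (le_abs_self _)
    gcongr
    exact le_abs_self c

/-! ### Modifications for squares of pseudo-metrics. -/

/-- `d` is the square of a pseudo-metric. -/
structure IsSqPseudoMetric {Y : Type*} (d : Y → Y → ℝ) : Prop where
  nonneg : ∀ x y, 0 ≤ d x y
  self : ∀ x, d x x = 0
  symm : ∀ x y, d x y = d y x
  triangle : ∀ x y z, √(d x z) ≤ √(d x y) + √(d y z)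

theorem sqrt_rpow_two_mul {a : ℝ} (ha : 0 ≤ a) (s : ℝ) : √a ^ (2 * s) = a ^ s := by
  rw [Real.sqrt_eq_rpow, ← Real.rpow_mul ha]
  congr 1
  ring

/-- The preceding theorem is applied to √d. A δ-net for √d is a δ²-net for d, so κ and α both
double; the resulting Hölder exponent 2α/β for √d is α/β for d. -/
theorem IsSqPseudoMetric.exists_modification {Y : Type*} {d : Y → Y → ℝ}
    (hd : IsSqPseudoMetric d) [CompleteSpace E] [SecondCountableTopology E]
    [Nonempty E] [MeasurableSpace E] [BorelSpace E]
    (P : Measure Ω) (ξ : Y → Ω → E) (hξ : ∀ x, Measurable (ξ x))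
    {A κ C α β : ℝ} (hA : 1 ≤ A) (hκ : 0 ≤ κ) (hC : 0 < C) (hα : 0 < α) (hβ : 0 < β)
    (hcov : ∀ δ : ℝ, 0 < δ → δ ≤ 1 → ∃ J : Finset Y, (J.card : ℝ) ≤ A * δ ^ (-κ) ∧
      ∀ x, ∃ y ∈ J, d x y ≤ δ)
    (hmom : ∀ s t, ∫⁻ ω, edist (ξ s ω) (ξ t ω) ^ β ∂P
      ≤ ENNReal.ofReal (C * d s t ^ (κ + α))) :
    ∃ ξ' : Y → Ω → E, (∀ x, Measurable (ξ' x)) ∧ (∀ x, ∀ᵐ ω ∂P, ξ' x ω = ξ x ω) ∧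
      ∀ᵐ ω ∂P, EssentiallyHolder d (α / β) (fun x => ξ' x ω) := by
  let _ : PseudoMetricSpace Y :=
    { dist := fun x y => √(d x y)
      dist_self := fun x => by simp [hd.self]
      dist_comm := fun x y => by simp [hd.symm x y]
      dist_triangle := hd.triangle }
  have hdist : ∀ x y : Y, dist x y = √(d x y) := fun _ _ => rfl
  obtain ⟨ξ', h1, h2, h3⟩ := exists_essentiallyHolder_modification P ξ hξ (A := A) (κ := 2 * κ)
    (C := C) (α := 2 * α) (β := β) hA (by linarith) hC (by linarith) hβ
    (fun δ h0 h1 => by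
      obtain ⟨J, hJ, hJ'⟩ := hcov (δ ^ 2) (by positivity) (pow_le_one₀ h0.le h1)
      refine ⟨J, ?_, fun x => ?_⟩
      · rwa [← Real.rpow_natCast, ← Real.rpow_mul h0.le, Nat.cast_ofNat, mul_neg] at hJ
      · obtain ⟨y, hy, hxy⟩ := hJ' x
        exact ⟨y, hy, by rw [hdist]; exact Real.sqrt_le_iff.2 ⟨h0.le, hxy⟩⟩)
    (fun s t => by
      rw [hdist, ← mul_add, sqrt_rpow_two_mul (hd.nonneg s t)]
      exact hmom s t)
  refine ⟨ξ', h1, h2, ?_⟩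
  filter_upwards [h3] with ω hω
  refine essentiallyHolder_of_holder hd.nonneg (by positivity) fun η h0 h1 => ?_
  obtain ⟨c, hc⟩ := hω.2 (2 * η) (by linarith) (by rw [mul_div_assoc]; linarith)
  refine ⟨c, fun x y => ?_⟩
  rw [← sqrt_rpow_two_mul (hd.nonneg x y)]
  exact hc x y

/-- Two continuous functions that agree on a dense set agree everywhere. -/
theorem EssentiallyHolder.eq_of_dense {Y : Type*} {d : Y → Y → ℝ} {δ δ' : ℝ} {f g : Y → E}
    (hf : EssentiallyHolder d δ f) (hg : EssentiallyHolder d δ' g) {D : Set Y}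
    (hD : ∀ x, ∀ ε > 0, ∃ y ∈ D, d x y < ε) (h : ∀ y ∈ D, f y = g y) : f = g := by
  funext x
  refine eq_of_forall_dist_le fun ε hε => ?_
  obtain ⟨a, ha, hfa⟩ := hf.1 x (ε / 2) (by linarith)
  obtain ⟨b, hb, hgb⟩ := hg.1 x (ε / 2) (by linarith)
  obtain ⟨y, hy, hxy⟩ := hD x (min a b) (lt_min ha hb)
  have h1 := hfa y (hxy.trans_le (min_le_left _ _))
  have h2 := hgb y (hxy.trans_le (min_le_right _ _))
  rw [h y hy] at h1
  linarith [dist_triangle_right (f x) (g x) (g y)]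

theorem exists_countable_dense_of_cover {Y : Type*} {d : Y → Y → ℝ}
    (hcov : ∀ δ : ℝ, 0 < δ → δ ≤ 1 → ∃ J : Finset Y, ∀ x, ∃ y ∈ J, d x y ≤ δ) :
    ∃ D : Set Y, D.Countable ∧ ∀ x, ∀ ε > 0, ∃ y ∈ D, d x y < ε := by
  choose J hJ using fun n : ℕ => hcov ((1 / 2) ^ n) (by positivity)
    (pow_le_one₀ (by norm_num) (by norm_num))
  refine ⟨⋃ n, (J n : Set Y), Set.countable_iUnion fun n => (J n).countable_toSet,
    fun x ε hε => ?_⟩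
  obtain ⟨n, hn⟩ := exists_pow_lt_of_lt_one hε (y := (1 / 2 : ℝ)) (by norm_num)
  obtain ⟨y, hy, hxy⟩ := hJ n x
  exact ⟨y, Set.mem_iUnion.2 ⟨n, hy⟩, hxy.trans_lt hn⟩

/-- A modification that is continuous inherits the Hölder exponents given by the moments. -/
theorem IsSqPseudoMetric.essentiallyHolder_of_continuous {Y : Type*} {d : Y → Y → ℝ}
    (hd : IsSqPseudoMetric d) [CompleteSpace E] [SecondCountableTopology E]
    [Nonempty E] [MeasurableSpace E] [BorelSpace E]
    (P : Measure Ω) (ξ ξ' : Y → Ω → E) (hξ : ∀ x, Measurable (ξ x))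
    {A κ C α β δ' : ℝ} (hA : 1 ≤ A) (hκ : 0 ≤ κ) (hC : 0 < C) (hα : 0 < α) (hβ : 0 < β)
    (hcov : ∀ δ : ℝ, 0 < δ → δ ≤ 1 → ∃ J : Finset Y, (J.card : ℝ) ≤ A * δ ^ (-κ) ∧
      ∀ x, ∃ y ∈ J, d x y ≤ δ)
    (hmom : ∀ s t, ∫⁻ ω, edist (ξ s ω) (ξ t ω) ^ β ∂P
      ≤ ENNReal.ofReal (C * d s t ^ (κ + α)))
    (hmod : ∀ x, ∀ᵐ ω ∂P, ξ' x ω = ξ x ω)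
    (hcont : ∀ᵐ ω ∂P, EssentiallyHolder d δ' (fun x => ξ' x ω)) :
    ∀ᵐ ω ∂P, EssentiallyHolder d (α / β) (fun x => ξ' x ω) := by
  -- `ξ''` has the required exponent but is a priori only another modification; continuity and a
  -- countable dense set identify it with `ξ'` outside one null set.
  obtain ⟨ξ'', -, h2, h3⟩ := hd.exists_modification P ξ hξ hA hκ hC hα hβ hcov hmom
  obtain ⟨D, hDc, hD⟩ := exists_countable_dense_of_cover fun δ h0 h1 => by
    obtain ⟨J, -, hJ⟩ := hcov δ h0 h1
    exact ⟨J, hJ⟩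
  have h4 : ∀ᵐ ω ∂P, ∀ y ∈ D, ξ' y ω = ξ'' y ω := by
    rw [ae_ball_iff hDc]
    intro y _
    filter_upwards [hmod y, h2 y] with ω ha hb using ha.trans hb.symm
  filter_upwards [hcont, h3, h4] with ω ha hb hc
  rwa [ha.eq_of_dense hb hD hc]

end Kolmogorov

/-! ### Addresses, boundary points and the adjacency graph of cells. -/

namespace SelfSimilarSet

variable {M : ℕ} {F : Type*} [MetricSpace F]

theorem continuous_ψ (S : SelfSimilarSet M F) (i : Fin M) : Continuous (S.ψ i) := by
  obtain ⟨K, hK⟩ := S.contracting i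
  exact hK.2.continuous

theorem exists_ψ_eq (S : SelfSimilarSet M F) (x : F) : ∃ i y, S.ψ i y = x := by
  have : x ∈ ⋃ i, Set.range (S.ψ i) := S.cover ▸ Set.mem_univ x
  simpa using this

theorem wordMap_cons (S : SelfSimilarSet M F) {n : ℕ} (i : Fin M) (w : Fin n → Fin M) :
    S.wordMap (Fin.cons i w : Fin (n + 1) → Fin M) = S.ψ i ∘ S.wordMap w := by
  simp [wordMap]

variable [CompactSpace F] [Nonempty F]

theorem proj_eq_ψ_proj_shift (S : SelfSimilarSet M F) (τ : ℕ → Fin M) :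
    S.proj τ = S.ψ (τ 0) (S.proj fun k => τ (k + 1)) := by
  symm
  refine S.eq_proj τ _ fun n => ?_
  cases n with
  | zero => exact ⟨_, rfl⟩
  | succ n =>
    obtain ⟨y, hy⟩ := S.proj_mem (fun k => τ (k + 1)) n
    exact ⟨y, congrArg (S.ψ (τ 0)) hy⟩

theorem proj_surjective (S : SelfSimilarSet M F) : Function.Surjective S.proj := by
  intro x
  choose i y h using S.exists_ψ_eq
  -- An address of x is read off by repeatedly choosing a cell containing the point and passing to
  -- the preimage.
  have key : ∀ n x, x ∈ Set.range (S.wordMap (wordPrefix (fun k => i (y^[k] x)) n)) := by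
    intro n
    induction n with
    | zero => exact fun x => ⟨x, rfl⟩
    | succ n ih =>
      intro x
      obtain ⟨a, ha⟩ := ih (y x)
      refine ⟨a, ?_⟩
      conv_rhs => rw [← h x, ← ha]
      rfl
  exact ⟨_, (S.eq_proj _ x fun n => key n x).symm⟩

/-- Prepending `i` to an address of `a` gives an address of an overlap point, whose first shift is
the address of `a`. -/
theorem mem_boundary_of_overlap (S : SelfSimilarSet M F) {i : Fin M} {a : F}
    (h : S.ψ i a ∈ S.overlap) : a ∈ S.boundary := by
  obtain ⟨τ, rfl⟩ := S.proj_surjective a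
  refine ⟨τ, ⟨1, le_rfl, fun k => if k = 0 then i else τ (k - 1), ?_, ?_⟩, rfl⟩
  · rw [S.proj_eq_ψ_proj_shift]
    simpa using h
  · simp

/-- The post-critical set is stable under the shift, so the first letter can be split off inside the
boundary. -/
theorem exists_boundary_preimage (S : SelfSimilarSet M F) {p : F} (hp : p ∈ S.boundary) :
    ∃ i, ∃ q ∈ S.boundary, S.ψ i q = p := by
  obtain ⟨ω, ⟨n, hn, τ, hτ, rfl⟩, rfl⟩ := hp
  refine ⟨τ n, S.proj fun k => τ (k + (n + 1)), ⟨_, ⟨n + 1, by omega, τ, hτ, rfl⟩, rfl⟩, ?_⟩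
  rw [S.proj_eq_ψ_proj_shift fun k => τ (k + n)]
  simp [add_assoc, add_comm 1 n]

/-- Two cells are adjacent if they intersect. -/
def CellAdj (S : SelfSimilarSet M F) (i j : Fin M) : Prop :=
  i ≠ j ∧ ∃ p ∈ S.boundary, ∃ q ∈ S.boundary, S.ψ i p = S.ψ j q

theorem cellAdj_of_mem (S : SelfSimilarSet M F) {i j : Fin M} (hij : i ≠ j) {a b : F}
    (h : S.ψ i a = S.ψ j b) : S.CellAdj i j := by
  refine ⟨hij, a, S.mem_boundary_of_overlap (i := i) ⟨i, j, hij, ⟨a, rfl⟩, ⟨b, h.symm⟩⟩, b,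
    S.mem_boundary_of_overlap (i := j) ⟨i, j, hij, ⟨a, h⟩, ⟨b, rfl⟩⟩, h⟩

/-- The cells reachable from `i` and the remaining cells have closed unions covering F. If both were
nonempty they would meet by connectedness, and a common point makes a reachable cell adjacent to an
unreachable one. -/
theorem reflTransGen_cellAdj [ConnectedSpace F] (S : SelfSimilarSet M F) (i j : Fin M) :
    Relation.ReflTransGen S.CellAdj i j := by
  by_contra hj
  have hcl : ∀ I : Set (Fin M), IsClosed (⋃ k ∈ I, Set.range (S.ψ k)) := fun I =>
    I.toFinite.isClosed_biUnion fun k _ => (isCompact_range (S.continuous_ψ k)).isClosed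
  set I : Set (Fin M) := {k | Relation.ReflTransGen S.CellAdj i k} with hI
  obtain ⟨x₀⟩ := ‹Nonempty F›
  have h := isPreconnected_closed_iff.1 (isPreconnected_univ (α := F)) _ _ (hcl I) (hcl Iᶜ)
    (fun x _ => by
      obtain ⟨k, y, rfl⟩ := S.exists_ψ_eq x
      by_cases hk : k ∈ I
      · exact Or.inl (Set.mem_biUnion hk ⟨y, rfl⟩)
      · exact Or.inr (Set.mem_biUnion hk ⟨y, rfl⟩))
    ⟨S.ψ i x₀, Set.mem_univ _, Set.mem_biUnion (show i ∈ I from Relation.ReflTransGen.refl) ⟨_, rfl⟩⟩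
    ⟨S.ψ j x₀, Set.mem_univ _, Set.mem_biUnion (show j ∈ Iᶜ from hj) ⟨_, rfl⟩⟩
  obtain ⟨x, -, hx1, hx2⟩ := h
  simp only [Set.mem_iUnion] at hx1 hx2
  obtain ⟨k, hk, a, rfl⟩ := hx1
  obtain ⟨l, hl, b, hb⟩ := hx2
  have hkl : k ≠ l := by
    rintro rfl
    exact hl hk
  exact hl (Relation.ReflTransGen.tail hk (S.cellAdj_of_mem hkl hb.symm))

theorem boundary_nonempty [ConnectedSpace F] (S : SelfSimilarSet M F) : S.boundary.Nonempty := by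
  have hM := S.two_le
  rcases (S.reflTransGen_cellAdj ⟨0, by omega⟩ ⟨1, by omega⟩).cases_head with h | ⟨k, hk, -⟩
  · simp at h
  · obtain ⟨-, p, hp, -⟩ := hk
    exact ⟨p, hp⟩

theorem exists_vertex_near [ConnectedSpace F] (S : SelfSimilarSet M F) (x : F) {ε : ℝ}
    (hε : 0 < ε) : ∃ n, ∃ y ∈ S.vertices n, dist y x < ε := by
  obtain ⟨K, hK1, hK⟩ := S.exists_ratio
  obtain ⟨τ, rfl⟩ := S.proj_surjective x
  obtain ⟨p, hp⟩ := S.boundary_nonempty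
  have ht : Filter.Tendsto (fun n : ℕ => (K : ℝ) ^ n * Metric.diam (Set.univ : Set F))
      Filter.atTop (nhds (0 * Metric.diam (Set.univ : Set F))) :=
    (tendsto_pow_atTop_nhds_zero_of_lt_one K.2 (by exact_mod_cast hK1)).mul_const _
  rw [zero_mul] at ht
  obtain ⟨n, hn⟩ := (ht.eventually (gt_mem_nhds hε)).exists
  obtain ⟨a, ha⟩ := S.proj_mem τ n
  refine ⟨n, S.wordMap (wordPrefix τ n) p, Set.mem_iUnion.2 ⟨_, p, hp, rfl⟩, ?_⟩
  rw [← ha]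
  refine lt_of_le_of_lt ?_ hn
  refine ((S.lipschitzWith_wordMap hK n (wordPrefix τ n)).dist_le_mul p a).trans ?_
  push_cast
  gcongr
  exact Metric.dist_le_diam_of_mem isCompact_univ.isBounded (Set.mem_univ _) (Set.mem_univ _)

end SelfSimilarSet

/-! ### Energy forms and oscillation bounds. -/

section Energy

/-- Increments controlled by the square root of a functional are controlled along paths. -/
theorem exists_bound_of_reflTransGen {ι V : Type*} (D : ι → ι → V → ℝ) (e : V → ℝ)
    (hself : ∀ a, ∃ K, ∀ v, D a a v ≤ K * e v)
    (htri : ∀ a b c v, D a c v ≤ D a b v + D b c v) {Rel : ι → ι → Prop}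
    (hrel : ∀ a b, Rel a b → ∃ K, ∀ v, D a b v ≤ K * e v) {a b : ι}
    (h : Relation.ReflTransGen Rel a b) : ∃ K, ∀ v, D a b v ≤ K * e v := by
  induction h with
  | refl => exact hself a
  | tail _ h ih =>
    obtain ⟨K₁, h₁⟩ := ih
    obtain ⟨K₂, h₂⟩ := hrel _ _ h
    exact ⟨K₁ + K₂, fun v => (htri _ _ _ v).trans (by rw [add_mul]; exact add_le_add (h₁ v) (h₂ v))⟩

theorem exists_uniform_bound {ι V : Type*} [Finite ι] (D : ι → V → ℝ) (e : V → ℝ)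
    (he : ∀ v, 0 ≤ e v) (h : ∀ a, ∃ K, ∀ v, D a v ≤ K * e v) :
    ∃ K, 0 ≤ K ∧ ∀ a v, D a v ≤ K * e v := by
  choose K hK using h
  obtain ⟨B, hB⟩ := (Set.finite_range K).bddAbove
  refine ⟨max B 0, le_max_right _ _, fun a v => (hK a v).trans ?_⟩
  gcongr
  · exact he v
  · exact (hB ⟨a, rfl⟩).trans (le_max_left _ _)

variable {M : ℕ} {F : Type*} [MetricSpace F] [CompactSpace F] [Nonempty F] {S : PCFSet M F}

theorem levelEnergy_zero (A : Matrix S.boundary S.boundary ℝ) (r : Fin M → ℝ) (u : F → ℝ) :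
    levelEnergy S A r 0 u = boundaryEnergy S A fun p => u p := by
  simp [levelEnergy, SelfSimilarSet.wordMap]

theorem levelEnergy_succ (A : Matrix S.boundary S.boundary ℝ) (r : Fin M → ℝ) (m : ℕ)
    (u : F → ℝ) :
    levelEnergy S A r (m + 1) u = ∑ i, (r i)⁻¹ * levelEnergy S A r m (u ∘ S.ψ i) := by
  unfold levelEnergy
  rw [← (Fin.consEquiv fun _ => Fin M).sum_comp, Fintype.sum_prod_type]
  refine Finset.sum_congr rfl fun i _ => ?_
  rw [Finset.mul_sum]
  refine Finset.sum_congr rfl fun w _ => ?_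
  simp [Fin.consEquiv, Fin.prod_univ_succ, SelfSimilarSet.wordMap_cons, mul_assoc,
    mul_left_comm]

namespace RegularHarmonicStructure

variable (H : RegularHarmonicStructure S)

theorem boundaryEnergy_nonneg (u : S.boundary → ℝ) : 0 ≤ boundaryEnergy S H.A u := by
  have := H.nonpos u
  unfold boundaryEnergy
  linarith

theorem levelEnergy_nonneg (m : ℕ) (u : F → ℝ) : 0 ≤ levelEnergy S H.A H.r m u :=
  Finset.sum_nonneg fun _ _ => mul_nonneg
    (inv_nonneg.2 (Finset.prod_nonneg fun _ _ => (H.r_pos _).le)) (H.boundaryEnergy_nonneg _)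

theorem sum_row (p : S.boundary) : ∑ q, H.A p q = 0 := by
  have h := congrFun ((H.ker_eq fun _ => 1).2 ⟨1, fun _ => rfl⟩) p
  simpa [Matrix.mulVec, dotProduct] using h

/-- Constants lie in the kernel, so the rows of `A` sum to zero and the diagonal can be eliminated.
-/
theorem boundaryEnergy_eq (u : S.boundary → ℝ) :
    boundaryEnergy S H.A u = (1 / 2) * ∑ p, ∑ q, H.A p q * (u p - u q) ^ 2 := by
  have h1 : ∑ p, ∑ q, H.A p q * u p ^ 2 = 0 := by
    simp_rw [← Finset.sum_mul, H.sum_row, zero_mul, Finset.sum_const_zero]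
  have h2 : ∑ p, ∑ q, H.A p q * u q ^ 2 = 0 := by
    rw [Finset.sum_comm, ← h1]
    refine Finset.sum_congr rfl fun p _ => Finset.sum_congr rfl fun q _ => ?_
    rw [H.symm.apply]
  have h3 : ∑ p, ∑ q, H.A p q * (u p - u q) ^ 2 = ∑ p, ∑ q, H.A p q * u p ^ 2 +
      ∑ p, ∑ q, H.A p q * u q ^ 2 - 2 * ∑ p, ∑ q, u p * (H.A p q * u q) := by
    simp_rw [Finset.mul_sum, ← Finset.sum_add_distrib, ← Finset.sum_sub_distrib]
    refine Finset.sum_congr rfl fun p _ => Finset.sum_congr rfl fun q _ => ?_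
    ring
  rw [h3, h1, h2]
  simp only [boundaryEnergy, dotProduct, Matrix.mulVec, Finset.mul_sum]
  simp_rw [zero_add, zero_sub, mul_neg, Finset.mul_sum]
  congr 1
  refine Finset.sum_congr rfl fun p _ => Finset.sum_congr rfl fun q _ => ?_
  ring

theorem levelEnergy_affine (m : ℕ) (u : F → ℝ) (a b : ℝ) :
    levelEnergy S H.A H.r m (fun x => a * u x + b) = a ^ 2 * levelEnergy S H.A H.r m u := by
  unfold levelEnergy
  rw [Finset.mul_sum]
  refine Finset.sum_congr rfl fun w _ => ?_
  rw [mul_left_comm, H.boundaryEnergy_eq, H.boundaryEnergy_eq, mul_left_comm (a ^ 2)]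
  congr 2
  simp_rw [Finset.mul_sum]
  refine Finset.sum_congr rfl fun p _ => Finset.sum_congr rfl fun q _ => ?_
  ring

theorem sq_sub_le_of_edge {p q : S.boundary} (hA : 0 < H.A p q)
    (u : S.boundary → ℝ) : (u p - u q) ^ 2 ≤ 2 * (H.A p q)⁻¹ * boundaryEnergy S H.A u := by
  have hnn : ∀ p q, 0 ≤ H.A p q * (u p - u q) ^ 2 := by
    intro p q
    by_cases h : p = q
    · simp [h]
    · exact mul_nonneg (H.offDiag_nonneg p q h) (sq_nonneg _)
  have h1 : H.A p q * (u p - u q) ^ 2 ≤ ∑ p, ∑ q, H.A p q * (u p - u q) ^ 2 :=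
    (Finset.single_le_sum (f := fun q => H.A p q * (u p - u q) ^ 2) (fun q _ => hnn p q)
      (Finset.mem_univ q)).trans
    (Finset.single_le_sum (f := fun p => ∑ q, H.A p q * (u p - u q) ^ 2)
      (fun p _ => Finset.sum_nonneg fun q _ => hnn p q) (Finset.mem_univ p))
  rw [H.boundaryEnergy_eq]
  calc (u p - u q) ^ 2 = (H.A p q)⁻¹ * (H.A p q * (u p - u q) ^ 2) := by field_simp
    _ ≤ (H.A p q)⁻¹ * ∑ p, ∑ q, H.A p q * (u p - u q) ^ 2 := by gcongr
    _ = _ := by ring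

/-- The indicator of the component of `p` lies in the kernel of `A`, hence is constant. -/
theorem reflTransGen_edge (p q : S.boundary) :
    Relation.ReflTransGen (fun a b => a ≠ b ∧ 0 < H.A a b) p q := by
  classical
  set Rel := Relation.ReflTransGen (fun a b : S.boundary => a ≠ b ∧ 0 < H.A a b) p with hRel
  set u : S.boundary → ℝ := fun a => if Rel a then 1 else 0 with hu
  have h0 : ∀ a b, Rel a → ¬ Rel b → H.A a b = 0 := by
    intro a b ha hb
    have hab : a ≠ b := by
      rintro rfl
      exact hb ha
    refine le_antisymm (not_lt.1 fun h => hb (ha.tail ⟨hab, h⟩)) (H.offDiag_nonneg a b hab)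
  have hker : H.A.mulVec u = 0 := by
    funext a
    simp only [Matrix.mulVec, dotProduct, Pi.zero_apply]
    by_cases ha : Rel a
    · rw [← H.sum_row a]
      refine Finset.sum_congr rfl fun b _ => ?_
      by_cases hb : Rel b
      · simp [hu, hb]
      · simp [hu, hb, h0 a b ha hb]
    · refine Finset.sum_eq_zero fun b _ => ?_
      by_cases hb : Rel b
      · rw [H.symm.apply a b |>.symm, h0 b a hb ha, zero_mul]
      · simp [hu, hb]
  obtain ⟨c, hc⟩ := (H.ker_eq u).1 hker
  have hp : u p = 1 := by simp [hu, hRel, Relation.ReflTransGen.refl]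
  have hq : u q = 1 := by rw [hc q, ← hc p, hp]
  by_contra hn
  simp [hu, hn] at hq

theorem exists_boundary_osc : ∃ K, 0 ≤ K ∧ ∀ (u : S.boundary → ℝ) (p q : S.boundary),
    |u p - u q| ≤ K * √(boundaryEnergy S H.A u) := by
  obtain ⟨K, hK0, hK⟩ := exists_uniform_bound (ι := S.boundary × S.boundary)
    (fun a (u : S.boundary → ℝ) => |u a.1 - u a.2|) (fun u => √(boundaryEnergy S H.A u))
    (fun _ => Real.sqrt_nonneg _) (fun a =>
      exists_bound_of_reflTransGen (fun p q (u : S.boundary → ℝ) => |u p - u q|) _ (fun p => ⟨0, fun u => by simp⟩)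
        (fun p q s u => abs_sub_le _ _ _)
        (fun p q hpq => ⟨√(2 * (H.A p q)⁻¹), fun u => by
          rw [← Real.sqrt_mul (by have := hpq.2; positivity)]
          exact Real.abs_le_sqrt (H.sq_sub_le_of_edge hpq.2 u)⟩)
        (H.reflTransGen_edge a.1 a.2))
  exact ⟨K, hK0, fun u p q => hK (p, q) u⟩

theorem levelEnergy_comp_ψ_le (i : Fin M) (m : ℕ) (u : F → ℝ) :
    levelEnergy S H.A H.r m (u ∘ S.ψ i) ≤ H.r i * levelEnergy S H.A H.r (m + 1) u := by
  rw [levelEnergy_succ]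
  have h := Finset.single_le_sum (f := fun i => (H.r i)⁻¹ * levelEnergy S H.A H.r m (u ∘ S.ψ i))
    (fun i _ => mul_nonneg (inv_nonneg.2 (H.r_pos i).le) (H.levelEnergy_nonneg _ _))
    (Finset.mem_univ i)
  have h1 := H.r_pos i
  calc levelEnergy S H.A H.r m (u ∘ S.ψ i)
      = H.r i * ((H.r i)⁻¹ * levelEnergy S H.A H.r m (u ∘ S.ψ i)) := by field_simp
    _ ≤ _ := by gcongr

/-- Within a cell the oscillation is bounded by the boundary estimate; adjacent cells share a
boundary image, and every two cells are linked by adjacencies. -/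
theorem exists_osc_level_one [ConnectedSpace F] : ∃ K, 0 ≤ K ∧ ∀ (u : F → ℝ) (i j : Fin M),
    ∀ p ∈ S.boundary, ∀ q ∈ S.boundary,
      |u (S.ψ i p) - u (S.ψ j q)| ≤ K * √(levelEnergy S H.A H.r 1 u) := by
  obtain ⟨K₀, hK₀, hK⟩ := H.exists_boundary_osc
  have hcell : ∀ (u : F → ℝ) i, ∀ p ∈ S.boundary, ∀ q ∈ S.boundary,
      |u (S.ψ i p) - u (S.ψ i q)| ≤ K₀ * √(levelEnergy S H.A H.r 1 u) := by
    intro u i p hp q hq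
    refine (hK (fun p => u (S.ψ i p)) ⟨p, hp⟩ ⟨q, hq⟩).trans ?_
    gcongr
    have h := H.levelEnergy_comp_ψ_le i 0 u
    rw [levelEnergy_zero] at h
    refine h.trans (mul_le_of_le_one_left (H.levelEnergy_nonneg _ _) (H.r_lt_one i).le)
  obtain ⟨p₀, hp₀⟩ := S.boundary_nonempty
  obtain ⟨K, hK0, hK⟩ := exists_uniform_bound (ι := Fin M × Fin M)
    (fun a (u : F → ℝ) => |u (S.ψ a.1 p₀) - u (S.ψ a.2 p₀)|)
    (fun u => √(levelEnergy S H.A H.r 1 u))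
    (fun _ => Real.sqrt_nonneg _) (fun a =>
      exists_bound_of_reflTransGen (fun i j (u : F → ℝ) => |u (S.ψ i p₀) - u (S.ψ j p₀)|)
        (fun u => √(levelEnergy S H.A H.r 1 u))
        (fun p => ⟨0, fun u => by simp⟩) (fun p q s u => abs_sub_le _ _ _)
        (fun i j hij => ⟨K₀ + K₀, fun u => by
          obtain ⟨-, p, hp, q, hq, hpq⟩ := hij
          have h1 := hcell u i p₀ hp₀ p hp
          have h2 := hcell u j q hq p₀ hp₀
          rw [hpq] at h1
          have := abs_sub_le (u (S.ψ i p₀)) (u (S.ψ j q)) (u (S.ψ j p₀))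
          rw [add_mul]
          linarith⟩)
        (S.reflTransGen_cellAdj a.1 a.2))
  refine ⟨K₀ + K + K₀, by positivity, fun u i j p hp q hq => ?_⟩
  have h1 := hcell u i p hp p₀ hp₀
  have h2 := hK (i, j) u
  have h3 := hcell u j p₀ hp₀ q hq
  have h4 := abs_sub_le (u (S.ψ i p)) (u (S.ψ i p₀)) (u (S.ψ j q))
  have h5 := abs_sub_le (u (S.ψ i p₀)) (u (S.ψ j p₀)) (u (S.ψ j q))
  rw [add_mul, add_mul]
  linarith

theorem exists_r_le : ∃ ρ, 0 < ρ ∧ ρ < 1 ∧ ∀ i, H.r i ≤ ρ := by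
  have hM := S.two_le
  have : Nonempty (Fin M) := ⟨⟨0, by omega⟩⟩
  obtain ⟨i, hi⟩ := Finite.exists_max H.r
  exact ⟨H.r i, H.r_pos i, H.r_lt_one i, hi⟩

theorem exists_le_r : ∃ ρ, 0 < ρ ∧ ρ ≤ 1 ∧ ∀ i, ρ ≤ H.r i := by
  have hM := S.two_le
  have : Nonempty (Fin M) := ⟨⟨0, by omega⟩⟩
  obtain ⟨i, hi⟩ := Finite.exists_min H.r
  exact ⟨H.r i, H.r_pos i, (H.r_lt_one i).le, hi⟩

/-- Composition with ψ_i multiplies the energy bound by at most ρ = max r_i, so the k-th descent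
costs at most K √ρ^k √e. The constant K / (1 - √ρ) is the fixed point of c ↦ c √ρ + K. -/
theorem exists_osc_vertices [ConnectedSpace F] : ∃ K, 0 ≤ K ∧ ∀ (n : ℕ) (u : F → ℝ) (e : ℝ),
    (∀ m, levelEnergy S H.A H.r m u ≤ e) → ∀ x ∈ S.vertices n, ∀ q ∈ S.boundary,
      |u x - u q| ≤ K * √e := by
  obtain ⟨K, hK0, hK⟩ := H.exists_osc_level_one
  obtain ⟨ρ, hρ0, hρ1, hρ⟩ := H.exists_r_le
  have hs1 : √ρ < 1 := by
    rw [Real.sqrt_lt' one_pos]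
    simpa using hρ1
  have hs : 0 < 1 - √ρ := by linarith
  have hone : ∀ (u : F → ℝ) (e : ℝ), (∀ m, levelEnergy S H.A H.r m u ≤ e) → ∀ i,
      ∀ p ∈ S.boundary, ∀ q ∈ S.boundary, |u (S.ψ i p) - u q| ≤ K * √e := by
    intro u e he i p hp q hq
    obtain ⟨j, q', hq', rfl⟩ := S.exists_boundary_preimage hq
    refine (hK u i j p hp q' hq').trans ?_
    gcongr
    exact he 1
  have hKK : K ≤ K / (1 - √ρ) := by
    rw [le_div_iff₀ hs]
    nlinarith [Real.sqrt_nonneg ρ]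
  refine ⟨K / (1 - √ρ), by positivity, fun n => ?_⟩
  induction n with
  | zero =>
    intro u e he x hx q hq
    simp only [SelfSimilarSet.vertices, Set.mem_iUnion] at hx
    obtain ⟨w, p, hp, rfl⟩ := hx
    change |u p - u q| ≤ _
    obtain ⟨j, p', hp', rfl⟩ := S.exists_boundary_preimage hp
    exact (hone u e he j p' hp' q hq).trans (by gcongr)
  | succ n ih =>
    intro u e he x hx q hq
    simp only [SelfSimilarSet.vertices, Set.mem_iUnion] at hx
    obtain ⟨w, p, hp, rfl⟩ := hx
    have he0 : 0 ≤ e := (H.levelEnergy_nonneg 0 u).trans (he 0)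
    have h1 := ih (u ∘ S.ψ (w 0)) (ρ * e) (fun m => by
      refine (H.levelEnergy_comp_ψ_le (w 0) m u).trans ?_
      exact mul_le_mul (hρ _) (he _) (H.levelEnergy_nonneg _ _) hρ0.le)
      (S.wordMap (Fin.tail w) p) (Set.mem_iUnion.2 ⟨_, p, hp, rfl⟩) q hq
    have h2 := hone u e he (w 0) q hq q hq
    rw [Real.sqrt_mul hρ0.le] at h1
    have h3 := abs_sub_le (u (S.wordMap w p)) (u (S.ψ (w 0) q)) (u q)
    have h4 : K / (1 - √ρ) * (√ρ * √e) + K * √e = K / (1 - √ρ) * √e := by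
      field_simp
      ring
    change |u (S.wordMap w p) - u (S.ψ (w 0) q)| ≤ _ at h1
    linarith

/-- Functions of finite energy have bounded oscillation. -/
theorem exists_osc_bound [ConnectedSpace F] : ∃ K, 0 < K ∧ ∀ (f : C(F, ℝ)) (e : ℝ),
    (∀ m, levelEnergy S H.A H.r m f ≤ e) → ∀ x y, (f x - f y) ^ 2 ≤ K * e := by
  obtain ⟨K, hK0, hK⟩ := H.exists_osc_vertices
  obtain ⟨q, hq⟩ := S.boundary_nonempty
  refine ⟨(2 * K) ^ 2 + 1, by positivity, fun f e he x y => ?_⟩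
  have he0 : 0 ≤ e := (H.levelEnergy_nonneg 0 f).trans (he 0)
  have h1 : ∀ x, |f x - f q| ≤ K * √e := by
    intro x
    have hcl : IsClosed {x | |f x - f q| ≤ K * √e} :=
      isClosed_le (by fun_prop) continuous_const
    -- Continuity extends the bound from the vertices of all levels, which are dense, to F.
    have hd : Dense {x | |f x - f q| ≤ K * √e} := by
      refine Metric.dense_iff.2 fun x ε hε => ?_
      obtain ⟨n, y, hy, hyx⟩ := S.exists_vertex_near x hε
      exact ⟨y, hyx, hK n f e he y hy q hq⟩
    exact (hcl.closure_eq ▸ hd x :)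
  have h2 := abs_sub_le (f x) (f q) (f y)
  rw [abs_sub_comm (f q)] at h2
  have h3 : |f x - f y| ≤ 2 * K * √e := by linarith [h1 x, h1 y]
  rw [← sq_abs]
  calc |f x - f y| ^ 2 ≤ (2 * K * √e) ^ 2 := by gcongr
    _ = (2 * K) ^ 2 * e := by rw [mul_pow, Real.sq_sqrt he0]
    _ ≤ _ := by gcongr; linarith

end RegularHarmonicStructure

end Energy

/-! ### The resistance metric and its covering numbers. -/

namespace RegularHarmonicStructure

variable {M : ℕ} {F : Type*} [MetricSpace F] [CompactSpace F] [Nonempty F] {S : PCFSet M F}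
  (H : RegularHarmonicStructure S)

theorem energy_le_iff (f : C(F, ℝ)) {e : ℝ} (he : 0 ≤ e) :
    H.energy f ≤ ENNReal.ofReal e ↔ ∀ m, levelEnergy S H.A H.r m f ≤ e := by
  simp only [energy, iSup_le_iff, ENNReal.ofReal_le_ofReal_iff he]

/-- The inequality `1 ≤ a * e` also covers a = 0: there is then no test function, the infimum is ∞
and its inverse is 0. -/
theorem inv_iInf_energy_le {x y : F} {a : ℝ} (ha : 0 ≤ a)
    (h : ∀ (g : C(F, ℝ)) (e : ℝ), (∀ m, levelEnergy S H.A H.r m g ≤ e) → g x = 0 → g y = 1 →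
      1 ≤ a * e) :
    (⨅ f ∈ {f : C(F, ℝ) | f ∈ H.domain ∧ f x = 0 ∧ f y = 1}, H.energy f)⁻¹ ≤
      ENNReal.ofReal a := by
  have hg : ∀ g ∈ {f : C(F, ℝ) | f ∈ H.domain ∧ f x = 0 ∧ f y = 1},
      1 ≤ a * (H.energy g).toReal := by
    rintro g ⟨hgd, hgx, hgy⟩
    refine h g _ ((H.energy_le_iff g ENNReal.toReal_nonneg).1 ?_) hgx hgy
    rw [ENNReal.ofReal_toReal (ne_of_lt hgd)]
  rw [ENNReal.inv_le_iff_inv_le]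
  refine le_iInf₂ fun g hgm => ?_
  have h1 := hg g hgm
  have ha' : 0 < a := lt_of_le_of_ne ha fun h0 => by
    rw [← h0] at h1
    linarith
  rw [← ENNReal.ofReal_inv_of_pos ha', ← ENNReal.ofReal_toReal (ne_of_lt hgm.1)]
  refine ENNReal.ofReal_le_ofReal ?_
  rwa [inv_le_iff_one_le_mul₀' ha']

theorem R_le {x y : F} {a : ℝ} (ha : 0 ≤ a)
    (h : ∀ (g : C(F, ℝ)) (e : ℝ), (∀ m, levelEnergy S H.A H.r m g ≤ e) → g x = 0 → g y = 1 →
      1 ≤ a * e) : H.R x y ≤ a :=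
  ENNReal.toReal_le_of_le_ofReal ha (H.inv_iInf_energy_le ha h)

theorem R_nonneg (x y : F) : 0 ≤ H.R x y := ENNReal.toReal_nonneg

theorem R_self (x : F) : H.R x x = 0 :=
  le_antisymm (H.R_le le_rfl fun g e _ h0 h1 => by rw [h0] at h1; norm_num at h1) (H.R_nonneg x x)

variable [ConnectedSpace F]

theorem exists_R_le : ∃ K, 0 < K ∧ ∀ x y, H.R x y ≤ K := by
  obtain ⟨K, hK0, hK⟩ := H.exists_osc_bound
  refine ⟨K, hK0, fun x y => H.R_le hK0.le fun g e he hx hy => ?_⟩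
  have := hK g e he x y
  rw [hx, hy] at this
  linarith

/-- The normalisation (f - f x) / (f y - f x) is a test function for R(x,y) with energy at most e /
(f x - f y)². -/
theorem sq_sub_le_R_mul (f : C(F, ℝ)) {e : ℝ} (he : ∀ m, levelEnergy S H.A H.r m f ≤ e)
    (x y : F) : (f x - f y) ^ 2 ≤ H.R x y * e := by
  obtain ⟨K, hK0, hK⟩ := H.exists_osc_bound
  have he0 : 0 ≤ e := (H.levelEnergy_nonneg 0 f).trans (he 0)
  rcases eq_or_ne (f x) (f y) with hxy | hxy
  · rw [hxy, sub_self, zero_pow two_ne_zero]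
    exact mul_nonneg (H.R_nonneg x y) he0
  have hd : 0 < (f x - f y) ^ 2 := by
    have := sub_ne_zero.2 hxy
    positivity
  have hepos : 0 < e := by
    have := hK f e he x y
    by_contra hn
    nlinarith
  have hyx : f y - f x ≠ 0 := sub_ne_zero.2 hxy.symm
  set g : C(F, ℝ) := ⟨fun z => (f y - f x)⁻¹ * f z + -((f y - f x)⁻¹ * f x), by fun_prop⟩ with hg
  set e' : ℝ := e / (f x - f y) ^ 2 with he'
  have he'0 : 0 < e' := by positivity
  have hge : H.energy g ≤ ENNReal.ofReal e' := by
    rw [H.energy_le_iff g he'0.le]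
    intro m
    change levelEnergy S H.A H.r m (fun z => (f y - f x)⁻¹ * f z + -((f y - f x)⁻¹ * f x)) ≤ e'
    rw [H.levelEnergy_affine, inv_pow, ← neg_sub (f x) (f y), neg_sq, he', div_eq_inv_mul]
    have := he m
    gcongr
  have hgx : g x = 0 := by simp [hg]
  have hgy : g y = 1 := by
    change (f y - f x)⁻¹ * f y + -((f y - f x)⁻¹ * f x) = 1
    field_simp
    ring
  set I := ⨅ f ∈ {f : C(F, ℝ) | f ∈ H.domain ∧ f x = 0 ∧ f y = 1}, H.energy f with hI
  have hIle : I ≤ ENNReal.ofReal e' :=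
    (iInf₂_le g ⟨lt_of_le_of_lt hge ENNReal.ofReal_lt_top, hgx, hgy⟩).trans hge
  -- A vanishing infimum would have inverse ∞, which `toReal` sends to 0; the oscillation bound
  -- excludes this.
  have hItop : I⁻¹ ≤ ENNReal.ofReal K := H.inv_iInf_energy_le hK0.le fun g e he hx hy => by
    have := hK g e he x y
    rw [hx, hy] at this
    linarith
  have h1 : e'⁻¹ ≤ H.R x y := by
    have h2 := ENNReal.toReal_mono (ne_top_of_le_ne_top ENNReal.ofReal_ne_top hItop)
      (ENNReal.inv_le_inv.2 hIle)
    rwa [← ENNReal.ofReal_inv_of_pos he'0, ENNReal.toReal_ofReal (by positivity)] at h2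
  rw [he', inv_div, div_le_iff₀ hepos] at h1
  exact h1

/-- A test function g for (x,z) of energy at most e satisfies 1 = |g x - g z| ≤ (√R(x,y) + √R(y,z))
√e. -/
theorem isSqPseudoMetric_R : IsSqPseudoMetric H.R where
  nonneg := H.R_nonneg
  self := H.R_self
  symm := by
    have h : ∀ x y, H.R x y ≤ H.R y x := fun x y => H.R_le (H.R_nonneg y x) fun g e he hx hy => by
      have := H.sq_sub_le_R_mul g he y x
      rw [hx, hy] at this
      linarith
    exact fun x y => le_antisymm (h x y) (h y x)
  triangle x y z := by
    refine (Real.sqrt_le_left (by positivity)).2 (H.R_le (by positivity) fun g e he hx hz => ?_)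
    have he0 : 0 ≤ e := (H.levelEnergy_nonneg 0 g).trans (he 0)
    have h1 := Real.abs_le_sqrt (H.sq_sub_le_R_mul g he x y)
    have h2 := Real.abs_le_sqrt (H.sq_sub_le_R_mul g he y z)
    have h3 := abs_sub_le (g x) (g y) (g z)
    rw [Real.sqrt_mul (H.R_nonneg _ _)] at h1 h2
    rw [hx, hz, zero_sub, abs_neg, abs_one] at h3
    rw [hx] at h1
    rw [hz] at h2
    have h4 : 1 ≤ (√(H.R x y) + √(H.R y z)) * √e := by
      rw [hx, hz] at *
      linarith
    calc (1 : ℝ) ≤ ((√(H.R x y) + √(H.R y z)) * √e) ^ 2 := one_le_pow₀ h4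
      _ = _ := by rw [mul_pow, Real.sq_sqrt he0]

theorem R_ψ_le (i : Fin M) (x y : F) : H.R (S.ψ i x) (S.ψ i y) ≤ H.r i * H.R x y := by
  have hr := H.r_pos i
  refine H.R_le (mul_nonneg hr.le (H.R_nonneg x y)) fun g e he hx hy => ?_
  have h := H.sq_sub_le_R_mul (g.comp ⟨S.ψ i, S.continuous_ψ i⟩) (e := H.r i * e) (fun m => by
    refine (H.levelEnergy_comp_ψ_le i m g).trans ?_
    have := he (m + 1)
    gcongr) x y
  simp only [ContinuousMap.comp_apply, ContinuousMap.coe_mk, hx, hy] at h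
  linarith

/-- The covering numbers of the resistance metric grow at most with exponent `dimH`. -/
theorem exists_R_cover : ∃ A : ℝ, 1 ≤ A ∧ ∀ δ : ℝ, 0 < δ → δ ≤ 1 →
    ∃ J : Finset F, (J.card : ℝ) ≤ A * δ ^ (-H.dimH) ∧ ∀ x, ∃ y ∈ J, H.R x y ≤ δ := by
  classical
  obtain ⟨K', hK', hRK'⟩ := H.exists_R_le
  obtain ⟨ρ, hρ0, hρ1, hρ⟩ := H.exists_r_le
  obtain ⟨c, hc0, hc1, hc⟩ := H.exists_le_r
  obtain ⟨hd0, hd⟩ := H.dimH_spec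
  set d := H.dimH with hdd
  obtain ⟨x₀⟩ := ‹Nonempty F›
  set K := max K' 1 with hK
  have hK1 : 1 ≤ K := le_max_right _ _
  have hRK : ∀ x y, H.R x y ≤ K := fun x y => (hRK' x y).trans (le_max_left _ _)
  -- For 1 ≤ δ ≤ 1/c, with c a lower bound of the r_i, one point suffices. This window catches δ /
  -- r_i when δ < 1.
  have hbase : ∀ δ : ℝ, 1 ≤ δ → δ ≤ c⁻¹ → ∃ J : Finset F, (J.card : ℝ) ≤ (c * δ) ^ (-d) ∧
      ∀ x, ∃ y ∈ J, H.R x y ≤ K * δ := by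
    intro δ h1 h2
    refine ⟨{x₀}, ?_, fun x => ⟨x₀, by simp, (hRK x x₀).trans (le_mul_of_one_le_right (by linarith) h1)⟩⟩
    rw [Finset.card_singleton, Nat.cast_one]
    refine Real.one_le_rpow_of_pos_of_le_one_of_nonpos (by positivity) ?_ (by linarith)
    calc c * δ ≤ c * c⁻¹ := by gcongr
      _ = 1 := mul_inv_cancel₀ hc0.ne'
  -- Covers of F at scales δ / r_i are transported into the cells; since ∑ r_i^d = 1, the counting
  -- bound is reproduced with the same constant. Dividing by r_i ≤ ρ raises the scale, so finitely
  -- many steps reach the base window.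
  have key : ∀ (n : ℕ) (δ : ℝ), ρ ^ n ≤ δ → δ ≤ c⁻¹ →
      ∃ J : Finset F, (J.card : ℝ) ≤ (c * δ) ^ (-d) ∧ ∀ x, ∃ y ∈ J, H.R x y ≤ K * δ := by
    intro n
    induction n with
    | zero => exact fun δ h1 h2 => hbase δ (by simpa using h1) h2
    | succ n ih =>
      intro δ h1 h2
      rcases le_or_gt 1 δ with h | h
      · exact hbase δ h h2
      have hδ0 : 0 < δ := lt_of_lt_of_le (by positivity) h1
      choose J hJ hJ' using fun i => ih (δ / H.r i)
        (by
          rw [le_div_iff₀ (H.r_pos i)]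
          refine le_trans ?_ h1
          rw [pow_succ]
          have := hρ i
          gcongr)
        (by
          rw [div_eq_mul_inv]
          calc δ * (H.r i)⁻¹ ≤ 1 * c⁻¹ := by
                have := hc i
                have := H.r_pos i
                gcongr
            _ = c⁻¹ := one_mul _)
      refine ⟨Finset.univ.biUnion fun i => (J i).image (S.ψ i), ?_, fun x => ?_⟩
      · calc (((Finset.univ.biUnion fun i => (J i).image (S.ψ i)).card : ℕ) : ℝ)
            ≤ ∑ i, ((J i).card : ℝ) := by
              exact_mod_cast Finset.card_biUnion_le.trans
                (Finset.sum_le_sum fun i _ => Finset.card_image_le)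
          _ ≤ ∑ i, (c * (δ / H.r i)) ^ (-d) := Finset.sum_le_sum fun i _ => hJ i
          _ = ∑ i, (c * δ) ^ (-d) * H.r i ^ d := by
              refine Finset.sum_congr rfl fun i _ => ?_
              rw [← mul_div_assoc, Real.div_rpow (by positivity) (H.r_pos i).le,
                Real.rpow_neg (H.r_pos i).le, div_inv_eq_mul]
          _ = (c * δ) ^ (-d) := by rw [← Finset.mul_sum, hd, mul_one]
      · obtain ⟨i, x, rfl⟩ := S.exists_ψ_eq x
        obtain ⟨y, hy, hxy⟩ := hJ' i x
        refine ⟨S.ψ i y, Finset.mem_biUnion.2 ⟨i, Finset.mem_univ i,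
          Finset.mem_image_of_mem _ hy⟩, (H.R_ψ_le i x y).trans ?_⟩
        have hr := H.r_pos i
        calc H.r i * H.R x y ≤ H.r i * (K * (δ / H.r i)) := by gcongr
          _ = K * δ := by field_simp
  refine ⟨(c / K) ^ (-d), Real.one_le_rpow_of_pos_of_le_one_of_nonpos (by positivity) ?_
    (by linarith), fun δ h0 h1 => ?_⟩
  · rw [div_le_one (by linarith)]
    linarith
  have hδK : 0 < δ / K := by positivity
  obtain ⟨n, hn⟩ := exists_pow_lt_of_lt_one hδK hρ1
  obtain ⟨J, hJ, hJ'⟩ := key n (δ / K) hn.le (by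
    calc δ / K ≤ 1 := by
          rw [div_le_one (by linarith)]
          linarith
      _ ≤ c⁻¹ := (one_le_inv₀ hc0).2 hc1)
  refine ⟨J, hJ.trans_eq ?_, fun x => ?_⟩
  · rw [← Real.mul_rpow (by positivity) h0.le]
    congr 1
    ring
  · obtain ⟨y, hy, hxy⟩ := hJ' x
    exact ⟨y, hy, hxy.trans_eq (by field_simp)⟩

end RegularHarmonicStructure

/-! ### Product distances, covers of [0,T] × F and comparison of moments. -/

theorem IsSqPseudoMetric.of_triangle {Y : Type*} {d : Y → Y → ℝ} (h0 : ∀ x y, 0 ≤ d x y)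
    (h1 : ∀ x, d x x = 0) (h2 : ∀ x y, d x y = d y x) (h3 : ∀ x y z, d x z ≤ d x y + d y z) :
    IsSqPseudoMetric d where
  nonneg := h0
  self := h1
  symm := h2
  triangle x y z := (Real.sqrt_le_sqrt (h3 x y z)).trans
    (Real.sqrt_le_iff.2 ⟨by positivity, by
      rw [add_sq, Real.sq_sqrt (h0 _ _), Real.sq_sqrt (h0 _ _)]
      have : 0 ≤ 2 * √(d x y) * √(d y z) := by positivity
      linarith⟩)

theorem IsSqPseudoMetric.prod {Y Z : Type*} {d : Y → Y → ℝ} {e : Z → Z → ℝ}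
    (hd : IsSqPseudoMetric d) (he : IsSqPseudoMetric e) :
    IsSqPseudoMetric fun p q : Y × Z => max (d p.1 q.1) (e p.2 q.2) where
  nonneg p q := le_max_of_le_left (hd.nonneg _ _)
  self p := by simp [hd.self, he.self]
  symm p q := by rw [hd.symm, he.symm]
  triangle p q s := by
    have hm : Monotone Real.sqrt := Real.sqrt_monotone
    rw [hm.map_max, hm.map_max, hm.map_max]
    exact max_le
      ((hd.triangle _ q.1 _).trans (add_le_add (le_max_left _ _) (le_max_left _ _)))
      ((he.triangle _ q.2 _).trans (add_le_add (le_max_right _ _) (le_max_right _ _)))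

theorem EssentiallyHolder.comp {X Y E : Type*} [MetricSpace E] {d : X → X → ℝ} {d' : Y → Y → ℝ}
    {δ : ℝ} {f : X → E} (hf : EssentiallyHolder d δ f) (φ : Y → X)
    (hφ : ∀ a b, d (φ a) (φ b) = d' a b) : EssentiallyHolder d' δ (fun y => f (φ y)) := by
  refine ⟨fun x ε hε => ?_, fun η h0 h1 => ?_⟩
  · obtain ⟨a, ha, h⟩ := hf.1 (φ x) ε hε
    exact ⟨a, ha, fun y hy => h _ (by rwa [hφ])⟩
  · obtain ⟨c, hc⟩ := hf.2 η h0 h1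
    exact ⟨c, fun x y => by rw [← hφ]; exact hc _ _⟩

theorem isSqPseudoMetric_abs_sub (s : Set ℝ) :
    IsSqPseudoMetric fun a b : s => |(a : ℝ) - (b : ℝ)| :=
  .of_triangle (fun _ _ => abs_nonneg _) (fun _ => by simp) (fun _ _ => abs_sub_comm _ _)
    (fun _ _ _ => abs_sub_le _ _ _)

theorem exists_Icc_cover {T : ℝ} (hT : 0 < T) {δ : ℝ} (h0 : 0 < δ) (h1 : δ ≤ 1) :
    ∃ J : Finset (Set.Icc (0 : ℝ) T), (J.card : ℝ) ≤ (T + 1) * δ ^ (-1 : ℝ) ∧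
      ∀ x : Set.Icc (0 : ℝ) T, ∃ y ∈ J, |(x : ℝ) - (y : ℝ)| ≤ δ := by
  classical
  refine ⟨(Finset.range (⌊T / δ⌋₊ + 1)).image fun k : ℕ =>
    ⟨min (k * δ) T, by positivity, min_le_right _ _⟩, ?_, fun x => ?_⟩
  · have h2 : ((Finset.range (⌊T / δ⌋₊ + 1)).card : ℝ) ≤ T / δ + 1 := by
      rw [Finset.card_range, Nat.cast_add, Nat.cast_one]
      have := Nat.floor_le (a := T / δ) (by positivity)
      linarith
    refine (Nat.cast_le.2 Finset.card_image_le).trans (h2.trans ?_)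
    rw [Real.rpow_neg_one, add_mul, one_mul, div_eq_mul_inv]
    have := (one_le_inv₀ h0).2 h1
    linarith
  · obtain ⟨x, hx0, hxT⟩ := x
    have h2 := Nat.floor_le (a := x / δ) (by positivity)
    have h3 := Nat.lt_floor_add_one (x / δ)
    rw [le_div_iff₀ h0] at h2
    rw [div_lt_iff₀ h0] at h3
    refine ⟨_, Finset.mem_image_of_mem _ (Finset.mem_range.2 (Nat.lt_succ_of_le
      (Nat.floor_le_floor (div_le_div_of_nonneg_right hxT h0.le)))), ?_⟩
    simp only
    rw [min_eq_left (h2.trans hxT), abs_le]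
    constructor <;> linarith

theorem exists_prod_cover {Y Z : Type*} {d : Y → Y → ℝ} {e : Z → Z → ℝ} {A B κ μ δ : ℝ}
    (hA : 0 ≤ A) (h0 : 0 < δ)
    (hd : ∃ J : Finset Y, (J.card : ℝ) ≤ A * δ ^ (-κ) ∧ ∀ x, ∃ y ∈ J, d x y ≤ δ)
    (he : ∃ J : Finset Z, (J.card : ℝ) ≤ B * δ ^ (-μ) ∧ ∀ x, ∃ y ∈ J, e x y ≤ δ) :
    ∃ J : Finset (Y × Z), (J.card : ℝ) ≤ A * B * δ ^ (-(μ + κ)) ∧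
      ∀ x : Y × Z, ∃ y ∈ J, max (d x.1 y.1) (e x.2 y.2) ≤ δ := by
  obtain ⟨J, hJ, hJ'⟩ := hd
  obtain ⟨K, hK, hK'⟩ := he
  refine ⟨J ×ˢ K, ?_, fun x => ?_⟩
  · rw [Finset.card_product, Nat.cast_mul, neg_add, Real.rpow_add h0]
    calc (J.card : ℝ) * K.card ≤ (A * δ ^ (-κ)) * (B * δ ^ (-μ)) := by gcongr
      _ = _ := by ring
  · obtain ⟨y, hy, hxy⟩ := hJ' x.1
    obtain ⟨z, hz, hxz⟩ := hK' x.2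
    exact ⟨(y, z), Finset.mk_mem_product hy hz, max_le hxy hxz⟩

theorem rpow_le_rpow_mul_of_le {u v D s s' : ℝ} (hu : 0 ≤ u) (huv : u ≤ v) (hvD : v ≤ D)
    (hs : 0 < s) (hss : s ≤ s') : u ^ s' ≤ D ^ (s' - s) * v ^ s := by
  have hv : 0 ≤ v := hu.trans huv
  calc u ^ s' ≤ v ^ s' := Real.rpow_le_rpow hu huv (hs.le.trans hss)
    _ = v ^ (s' - s) * v ^ s := by
        rw [← Real.rpow_add_of_nonneg hv (by linarith) hs.le, sub_add_cancel]
    _ ≤ _ := by gcongr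

/-- The bound (a + b)^β ≤ 2^β max(a^β, b^β) holds for every β > 0, including β < 1. -/
theorem lintegral_edist_triangle_le {Ω E : Type*} [MeasurableSpace Ω] [MetricSpace E]
    [SecondCountableTopology E] [MeasurableSpace E] [BorelSpace E] (P : Measure Ω)
    {X Y Z : Ω → E} (hX : Measurable X) (hY : Measurable Y) {β : ℝ} (hβ : 0 < β) :
    ∫⁻ ω, edist (X ω) (Z ω) ^ β ∂P ≤
      2 ^ β * (∫⁻ ω, edist (X ω) (Y ω) ^ β ∂P + ∫⁻ ω, edist (Y ω) (Z ω) ^ β ∂P) := by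
  rw [← lintegral_add_left ((hX.edist hY).pow_const β),
    ← lintegral_const_mul' _ _ (by finiteness)]
  refine lintegral_mono fun ω => ?_
  have h1 : edist (X ω) (Z ω) ≤ 2 * max (edist (X ω) (Y ω)) (edist (Y ω) (Z ω)) := by
    rw [two_mul]
    exact (edist_triangle _ _ _).trans (add_le_add (le_max_left _ _) (le_max_right _ _))
  refine (ENNReal.rpow_le_rpow h1 hβ.le).trans ?_
  rw [ENNReal.mul_rpow_of_nonneg _ _ hβ.le, (ENNReal.monotone_rpow_of_nonneg hβ.le).map_max]
  gcongr
  exact max_le le_self_add le_add_self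

end PCF

/-! ### Assembly of the joint and the sliced regularity. -/

theorem mainTheorem7
    {M : ℕ} {F : Type*} [MetricSpace F] [CompactSpace F] [ConnectedSpace F]
    (S : PCF.PCFSet M F) (H : PCF.RegularHarmonicStructure S)
    {E : Type*} [MetricSpace E] [CompleteSpace E] [TopologicalSpace.SeparableSpace E]
    [MeasurableSpace E] [BorelSpace E]
    {Ω : Type*} [MeasurableSpace Ω] (P : Measure Ω) [IsProbabilityMeasure P]
    (T : ℝ) (hT : 0 < T)
    (ξ : Set.Icc (0 : ℝ) T → F → Ω → E) (hξ : ∀ t x, Measurable (ξ t x))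
    (C β γ γ' : ℝ) (hC : 0 < C) (hβ : 0 < β) (hγ : 0 < γ) (hγ' : 0 < γ')
    (hspace : ∀ t x y, ∫⁻ ω, edist (ξ t x ω) (ξ t y ω) ^ β ∂P
      ≤ ENNReal.ofReal (C * H.R x y ^ (H.dimH + 1 + γ)))
    (htime : ∀ s t x, ∫⁻ ω, edist (ξ s x ω) (ξ t x ω) ^ β ∂P
      ≤ ENNReal.ofReal (C * |(s : ℝ) - (t : ℝ)| ^ (H.dimH + 1 + γ'))) :
    ∃ ξ' : Set.Icc (0 : ℝ) T → F → Ω → E,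
      (∀ t x, Measurable (ξ' t x)) ∧
      (∀ t x, ∀ᵐ ω ∂P, ξ' t x ω = ξ t x ω) ∧
      (∀ᵐ ω ∂P, PCF.EssentiallyHolder (H.Rinf T) (min γ γ' / β)
        (fun p : Set.Icc (0 : ℝ) T × F => ξ' p.1 p.2 ω)) ∧
      (∀ t, ∀ᵐ ω ∂P, PCF.EssentiallyHolder H.R ((1 + γ) / β) (fun x => ξ' t x ω)) ∧
      (∀ x, ∀ᵐ ω ∂P, PCF.EssentiallyHolder
        (fun s t : Set.Icc (0 : ℝ) T => |(s : ℝ) - (t : ℝ)|) ((H.dimH + γ') / β)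
        (fun t => ξ' t x ω)) := by
  have : SecondCountableTopology E := UniformSpace.secondCountable_of_separable E
  obtain ⟨x₀⟩ : Nonempty F := inferInstance
  obtain ⟨ω₀⟩ : Nonempty Ω := nonempty_of_isProbabilityMeasure P
  have : Nonempty E := ⟨ξ ⟨0, le_rfl, hT.le⟩ x₀ ω₀⟩
  have hd0 : 0 < H.dimH := H.dimH_spec.1
  obtain ⟨A, hA, hcovR⟩ := H.exists_R_cover
  obtain ⟨K, hK0, hRK⟩ := H.exists_R_le
  have htimed := PCF.isSqPseudoMetric_abs_sub (Set.Icc (0 : ℝ) T)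
  have hRd := H.isSqPseudoMetric_R
  have hinf : PCF.IsSqPseudoMetric (H.Rinf T) := htimed.prod hRd
  have hcovT := fun δ (h0 : (0 : ℝ) < δ) h1 => PCF.exists_Icc_cover hT h0 h1
  have hT1 : 1 ≤ T + 1 := by linarith
  have hm : 0 < min γ γ' := lt_min hγ hγ'
  set D : ℝ := max T K with hD
  have hD0 : 0 < D := lt_max_of_lt_left hT
  have hinfD : ∀ p q, H.Rinf T p q ≤ D := by
    rintro ⟨⟨s, hs0, hsT⟩, x⟩ ⟨⟨t, ht0, htT⟩, y⟩
    refine max_le_max ?_ (hRK x y)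
    simp only
    rw [abs_le]
    constructor <;> linarith
  set κ := H.dimH + 1 with hκ
  have hκ0 : 0 < κ := by linarith
  -- An increment from (s,x) to (t,y) passes through (s,y), which gives 2^β. The powers of the
  -- diameter bound `D` lower both exponents to κ + min γ γ'.
  obtain ⟨ξ', h1, h2, h3⟩ := hinf.exists_modification P (fun p => ξ p.1 p.2)
    (fun p => hξ p.1 p.2) (A := (T + 1) * A) (κ := κ) (α := min γ γ') (β := β)
    (C := 2 ^ β * (C * D ^ (γ - min γ γ') + C * D ^ (γ' - min γ γ')))
    (one_le_mul_of_one_le_of_one_le hT1 hA) hκ0.le (by positivity) hm hβ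
    (fun δ h0 h1 => PCF.exists_prod_cover (by linarith) h0 (hcovT δ h0 h1) (hcovR δ h0 h1))
    (fun p q => by
      refine (PCF.lintegral_edist_triangle_le P (Y := ξ p.1 q.2) (hξ _ _) (hξ _ _) hβ).trans ?_
      rw [mul_assoc, ENNReal.ofReal_mul (by positivity),
        ← ENNReal.ofReal_rpow_of_pos two_pos, ENNReal.ofReal_ofNat, add_mul,
        ENNReal.ofReal_add (by have := hinf.nonneg p q; positivity)
          (by have := hinf.nonneg p q; positivity)]
      refine mul_le_mul' le_rfl (add_le_add ((hspace _ _ _).trans ?_) ((htime _ _ _).trans ?_)) <;>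
      refine ENNReal.ofReal_le_ofReal ?_ <;> rw [mul_assoc]
      · have h := PCF.rpow_le_rpow_mul_of_le (hRd.nonneg p.2 q.2) (le_max_right _ _) (hinfD p q)
          (add_pos hκ0 hm) (add_le_add_right (min_le_left γ γ') κ)
        rw [add_sub_add_left_eq_sub] at h
        exact mul_le_mul_of_nonneg_left h hC.le
      · have h := PCF.rpow_le_rpow_mul_of_le (htimed.nonneg p.1 q.1) (le_max_left _ _) (hinfD p q)
          (add_pos hκ0 hm) (add_le_add_right (min_le_right γ γ') κ)
        rw [add_sub_add_left_eq_sub] at h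
        exact mul_le_mul_of_nonneg_left h hC.le)
  refine ⟨fun t x => ξ' (t, x), fun t x => h1 _, fun t x => h2 _, h3, fun t => ?_, fun x => ?_⟩
  -- On a slice the covering exponent is only d_H, so the rest of the moment exponent, 1 + γ, goes
  -- into regularity.
  · refine hRd.essentiallyHolder_of_continuous P (ξ t) (fun x => ξ' (t, x)) (hξ t) hA hd0.le hC
      (by linarith) hβ hcovR (fun x y => ?_) (fun x => h2 (t, x)) (h3.mono fun ω hω =>
        hω.comp (fun x => (t, x)) fun a b => ?_)
    · rw [← add_assoc]
      exact hspace t x y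
    · simp [PCF.RegularHarmonicStructure.Rinf, hRd.nonneg a b]
  · refine htimed.essentiallyHolder_of_continuous P (fun t => ξ t x) (fun t => ξ' (t, x))
      (fun t => hξ t x) hT1 zero_le_one hC (by linarith) hβ hcovT (fun s t => ?_)
      (fun t => h2 (t, x)) (h3.mono fun ω hω => hω.comp (fun t => (t, x)) fun a b => ?_)
    · rw [← add_assoc, add_comm 1]
      exact htime s t x
    · simp [PCF.RegularHarmonicStructure.Rinf, hRd.self x]
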